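/- Let $n\ge 1$, let $\Omega\subset\mathbb{R}^n$ be a bounded, open, convex set, and let $K:\Omega\to[0,\infty)$ be a Borel function with $\overline{\Omega}=\overline{\{x\in\Omega : K(x)>0\}}$ and critical mass $$\int_\Omega K(x)\,dx=\omega_n,$$ where $\omega_n$ is the Lebesgue measure of the unit ball of $\mathbb{R}^n$. Write points of $\mathbb{S}^n\subset\mathbb{R}^{n+1}$ as $\bar y=(y,y_{n+1})$ with $y\in\mathbb{R}^n$, and let $\mathbb{S}^n_-=\{\bar y\in\mathbb{S}^n : y_{n+1}<0\}$. Let $\Omega^*\subset\mathbb{S}^n_-$ be a Borel set with $\int_\Omega K\,dx=\int_{\Omega^*}(-y_{n+1})\,d\mathrm{Vol}_{\mathbb{S}^n}$, and put $c(x,\bar y)=\langle x,y\rangle/y_{n+1}$. Let $u:\Omega\to\mathbb{R}\cup\{+\infty\}$ be a Brenier solution of the optimal transport problem with cost $c$ from $\mu=K\,dx$ on $\Omega$ to $\nu=-y_{n+1}\mathbf 1_{\Omega^*}\,d\mathrm{Vol}_{\mathbb{S}^n}$. This means: $u$ is $c$-convex, i.e. $u(x)=\sup_{(\bar y,\lambda)\in\mathcal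 A}(-c(x,\bar y)+\lambda)$ on $\Omega$ for some nonempty $\mathcal A\subset\Omega^*\times\mathbb{R}$; and for $\mu$-a.e. $x$ the gradient $Du(x)$ exists, the point $T_u(x)\in\mathbb{S}^n_-$ with $-D_xc(x,T_u(x))=Du(x)$ is defined, and $T_u$ minimizes $\int_\Omega c(x,S(x))\,d\mu(x)$ among all measurable maps $S$ with $S_\#\mu=\nu$ (in particular $(T_u)_\#\mu=\nu$). For $x_0\in\Omega$ let $\partial u(x_0)=\{p\in\mathbb{R}^n : u(x)\ge u(x_0)+\langle p,x-x_0\rangle\ \ \forall x\in\Omega\}$. Suppose that there are $C_0,r_0,R_0>0$ and $\delta\in(0,1)$ such that $$K(x)\le \frac{C_0}{d(x,\partial\Omega)^{\delta}}\qquad\text{for all }x\in\Omega\text{ with } d(x,\partial\Omega)<r_0,$$ and such that every $z\in\partial\Omega$ lies on the boundary of a ball of radius at most $R_0$ which contains $\Omega$. Call $\rho\in(0,1)$, $L>0$, $C_1>1$ *Lipschitz constants of $\partial\Omega$* if for every $z\in\partial\Omega$ there are Euclidean coordinates $(y',y_n)\in\mathbb{R}^{n-1}\times\mathbb{R}$ and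 an $L$-Lipschitz function $\phi:\{|y'|<\rho\}\to(-C_1\rho,C_1\rho)$ such that, within the cylinder $\{|y'|<\rho,\ |y_n|<2C_1\rho\}$, the set $\Omega$ is $\{y_n>\phi(y')\}$, and such that $z$ belongs to $\{|y'|<\rho/2,\ |y_n|<C_1\rho\}$. Then Lipschitz constants of $\partial\Omega$ exist, and for all such constants $\rho,L,C_1$, every $x_0\in\Omega$ with $$d(x_0,\partial\Omega)\le\min\Big(\frac{\rho^2}{16(1+4R_0)},\ \frac{r_0}{2},\ \frac14\Big)$$ and every $p_0\in\partial u(x_0)$ satisfy $$|p_0|\ \ge\ \Lambda\, d(x_0,\partial\Omega)^{-\frac{1-\delta}{n+2}}-2,\qquad \Lambda=\left(\frac{1-\delta}{n\,2^n\,C_0\,(1+L)^{n-1}\,(6R_0+24R_0^2)^{\frac{n-1}{2}}}\right)^{\frac1{n+2}}.$$ -/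

import Mathlib

open MeasureTheory Metric Filter Topology
open scoped ENNReal InnerProductSpace

noncomputable section

namespace GaussOT

/-- Euclidean space `ℝⁿ`. -/
abbrev E (n : ℕ) : Type := EuclideanSpace ℝ (Fin n)

/-- The unit sphere `𝕊ⁿ` of `ℝⁿ⁺¹`; a point is written `ȳ = (y, yₙ₊₁)`, with `yₙ₊₁` the
coordinate of index `Fin.last n`. -/
abbrev Sph (n : ℕ) : Type := sphere (0 : E (n + 1)) 1

/-- The last coordinate `yₙ₊₁` of a point of `𝕊ⁿ`. -/
def lastCoord {n : ℕ} (y : Sph n) : ℝ := (y : E (n + 1)) (Fin.last n)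

/-- The open lower hemisphere `𝕊ⁿ₋`. -/
def lowerHemisphere (n : ℕ) : Set (Sph n) := {y | lastCoord y < 0}

/-- The volume (surface) measure of the round sphere `𝕊ⁿ`. -/
def sphereVolume (n : ℕ) : Measure (Sph n) := (volume : Measure (E (n + 1))).toSphere

/-- The cost `c(x, ȳ) = ⟨x, y⟩ / yₙ₊₁`. -/
def cost {n : ℕ} (x : E n) (y : Sph n) : ℝ :=
  (∑ i : Fin n, x i * (y : E (n + 1)) i.castSucc) / lastCoord y

/-- The source measure `K dx` on `Ω`. -/
def sourceMeasure {n : ℕ} (Ω : Set (E n)) (K : E n → ℝ) : Measure (E n) :=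
  (volume.restrict Ω).withDensity fun x => ENNReal.ofReal (K x)

/-- The target measure `-yₙ₊₁ 𝟙_{Ω*} dVol` on the sphere. -/
def targetMeasure {n : ℕ} (Ωs : Set (Sph n)) : Measure (Sph n) :=
  ((sphereVolume n).restrict Ωs).withDensity fun y => ENNReal.ofReal (-lastCoord y)

/-- `u` is `c`-convex on `Ω` with respect to `Ω*`: on `Ω` it is a supremum of functions
`x ↦ -c(x, ȳ) + l` with `ȳ ∈ Ω*`. The value `+∞` is allowed; the family is nonempty because
`u` does not take the value `-∞`. -/
def IsCConvex {n : ℕ} (Ω : Set (E n)) (Ωs : Set (Sph n)) (u : E n → EReal) : Prop :=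
  ∃ A : Set (Sph n × ℝ), A.Nonempty ∧ (∀ q ∈ A, q.1 ∈ Ωs) ∧
    ∀ x ∈ Ω, u x = ⨆ q ∈ A, ((-cost x q.1 + q.2 : ℝ) : EReal)

/-- `u` is finite near `x` and differentiable at `x` with gradient `p`. -/
def HasGradAt {n : ℕ} (u : E n → EReal) (p x : E n) : Prop :=
  (∀ᶠ z in 𝓝 x, u z ≠ ⊤ ∧ u z ≠ ⊥) ∧ HasGradientAt (fun z => (u z).toReal) p x

/-- `ȳ` is the image of `p` under the `c`-exponential map at `x`, the inverse of
`ȳ ↦ -D_x c(x, ȳ)` on the open lower hemisphere. -/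
def IsCExp {n : ℕ} (x p : E n) (y : Sph n) : Prop :=
  y ∈ lowerHemisphere n ∧ HasGradientAt (fun z => -cost z y) p x

/-- `T` solves the Monge problem between `μ` and `ν` for the cost `c`. For the source and target
measures above and a bounded `Ω` the cost of every competitor is integrable, because
`|c(x, ȳ)| * |yₙ₊₁| ≤ |x|` and the sphere has finite volume. -/
def IsMongeSolution {n : ℕ} (μ : Measure (E n)) (ν : Measure (Sph n)) (T : E n → Sph n) : Prop :=
  AEMeasurable T μ ∧ μ.map T = ν ∧
    ∀ S : E n → Sph n, AEMeasurable S μ → μ.map S = ν →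
      ∫ x, cost x (T x) ∂μ ≤ ∫ x, cost x (S x) ∂μ

/-- `u` is a Brenier solution of the transport problem from `K dx` on `Ω` to
`-yₙ₊₁ 𝟙_{Ω*} dVol`: it is `c`-convex, and the map `T_u(x) = c-Exp_x(Du(x))` is defined almost
everywhere for the source measure and solves the Monge problem. -/
def IsBrenierSolution {n : ℕ} (Ω : Set (E n)) (K : E n → ℝ) (Ωs : Set (Sph n))
    (u : E n → EReal) : Prop :=
  IsCConvex Ω Ωs u ∧ ∃ T : E n → Sph n,
    (∀ᵐ x ∂(sourceMeasure Ω K), ∃ p, HasGradAt u p x ∧ IsCExp x p (T x)) ∧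
      IsMongeSolution (sourceMeasure Ω K) (targetMeasure Ωs) T

/-- The subdifferential `∂u(x₀)` of `u` as a function on `Ω`. -/
def subdiff {n : ℕ} (Ω : Set (E n)) (u : E n → EReal) (x₀ : E n) : Set (E n) :=
  {p | ∀ x ∈ Ω, u x₀ + ((⟪p, x - x₀⟫_ℝ : ℝ) : EReal) ≤ u x}

/-- The distance `d(x, ∂Ω)`. -/
def bdist {n : ℕ} (Ω : Set (E n)) (x : E n) : ℝ := infDist x (frontier Ω)

/-- Every boundary point of `Ω` lies on the boundary of a ball of radius at most `R₀` that
contains `Ω`. -/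
def EnclosingBallCondition {n : ℕ} (Ω : Set (E n)) (R₀ : ℝ) : Prop :=
  ∀ z ∈ frontier Ω, ∃ (c : E n) (R : ℝ), 0 < R ∧ R ≤ R₀ ∧ Ω ⊆ ball c R ∧ z ∈ sphere c R

/-- The constants `ρ ∈ (0, 1)`, `L > 0`, `C₁ > 1` describe `∂Ω` locally as a Lipschitz graph:
every `z ∈ ∂Ω` has a Euclidean coordinate system, with origin `a` and last axis `e`
(a point is `a + y' + t e` with `y' ⟂ e`), and an `L`-Lipschitz function `φ` from the ball
`|y'| < ρ` to `(-C₁ρ, C₁ρ)`, such that in the cylinder `|y'| < ρ`, `|t| < 2C₁ρ` the set `Ω` is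
`{t > φ(y')}`, and `z` lies in the cylinder `|y'| < ρ/2`, `|t| < C₁ρ`. -/
def IsLipschitzBoundary {n : ℕ} (Ω : Set (E n)) (ρ L C₁ : ℝ) : Prop :=
  0 < ρ ∧ ρ < 1 ∧ 0 < L ∧ 1 < C₁ ∧
    ∀ z ∈ frontier Ω, ∃ (a e : E n) (φ : (Submodule.span ℝ {e})ᗮ → ℝ),
      ‖e‖ = 1 ∧
      (∀ y ∈ ball (0 : (Submodule.span ℝ {e})ᗮ) ρ, ∀ w ∈ ball (0 : (Submodule.span ℝ {e})ᗮ) ρ,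
        |φ y - φ w| ≤ L * ‖y - w‖) ∧
      (∀ y ∈ ball (0 : (Submodule.span ℝ {e})ᗮ) ρ, |φ y| < C₁ * ρ) ∧
      (∀ y ∈ ball (0 : (Submodule.span ℝ {e})ᗮ) ρ, ∀ t : ℝ, |t| < 2 * C₁ * ρ →
        (a + (y : E n) + t • e ∈ Ω ↔ φ y < t)) ∧
      ∃ y ∈ ball (0 : (Submodule.span ℝ {e})ᗮ) (ρ / 2), ∃ t : ℝ, |t| < C₁ * ρ ∧
        z = a + (y : E n) + t • e

/-- The constant `Λ`. -/
def blowupConst (n : ℕ) (C₀ R₀ L δ : ℝ) : ℝ :=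
  ((1 - δ) / (n * 2 ^ n * C₀ * (1 + L) ^ (n - 1) *
    (6 * R₀ + 24 * R₀ ^ 2) ^ (((n : ℝ) - 1) / 2))) ^ (1 / ((n : ℝ) + 2))

end GaussOT

end

/-! Since `-cost x y` is linear in `x` with slope `gnomonic y` (`neg_cost_eq_inner`), `u` is convex
and the gnomonic projection turns `T_u` into the gradient map `Du`. It turns the weighted hemisphere
measure into the density `(1 + |q|²)^(-(n+2)/2)` on `ℝⁿ`, of total mass `ωₙ`. As the mass is
critical, `Ω*` fills the hemisphere up to a null set, so every set of slopes must receive its full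
share of mass (`le_targetMeasure_gnomonic`).

Let `d = d(x₀, ∂Ω)`, let `z` be a nearest boundary point and put a thin cone of slopes at `p₀`, with
axis along the outward normal and opening `θ = d / (2√(R₀d))`. By monotonicity of the
subdifferential, a slope `p₀ + ξ` is used only at points `x` with `⟪ξ, x - x₀⟫ ≥ 0`
(`lintegral_gnomonicDensity_le`). The enclosing ball confines these points to a cap at `z` of width
about `√(R₀d)` and depth about `d` (`mem_cap_of_inner_nonneg`).

The cone carries mass at least of order `θ^(n-1) (|p₀| + 2)^(-(n+2))`
(`volume_truncatedCone_mul_le`). The decay of `K`, integrated over Lipschitz graph coordinates,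
gives the cap mass at most of order `(R₀d)^((n-1)/2) d^(1-δ)` (`setLIntegral_cap_le`). The opening
is proportional to the width of the cap, so the powers `n - 1` cancel and `(|p₀| + 2)^(n+2)` is at
least of order `d^(-(1-δ))`. -/

noncomputable section

namespace GaussOT

/-! ### Slicing orthogonally to a direction, and the volume of a cone. -/

/-- Tonelli in the orthogonal decomposition `ℝⁿ = e^⊥ ⊕ ℝ e`. -/
lemma lintegral_orthogonal_slices {V : Type*} [NormedAddCommGroup V] [InnerProductSpace ℝ V]
    [FiniteDimensional ℝ V] [MeasurableSpace V] [BorelSpace V] {e : V} (he : ‖e‖ = 1)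
    {f : V → ℝ≥0∞} (hf : Measurable f) :
    ∫⁻ x, f x = ∫⁻ y : (Submodule.span ℝ {e})ᗮ, ∫⁻ t : ℝ, f (y + t • e) := by
  set S := Submodule.span ℝ {e} with hS
  have h1 : MeasurePreserving (S.orthogonalDecomposition.symm) :=
    S.orthogonalDecomposition.symm.measurePreserving
  have h2 : MeasurePreserving (WithLp.toLp 2 : S × Sᗮ → WithLp 2 (S × Sᗮ)) :=
    WithLp.volume_preserving_toLp S Sᗮ
  let ψ : ℝ ≃ₗᵢ[ℝ] S := LinearIsometryEquiv.toSpanUnitSingleton e he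
  have h3 : MeasurePreserving ψ := ψ.measurePreserving
  have hg : Measurable fun p : S × Sᗮ => f ((p.1 : V) + p.2) :=
    hf.comp (by fun_prop : Continuous fun p : S × Sᗮ => (p.1 : V) + p.2).measurable
  have h4 : ∫⁻ x, f x = ∫⁻ p : S × Sᗮ, f ((p.1 : V) + p.2) := by
    rw [← (h1.comp h2).lintegral_comp hf]
    refine lintegral_congr fun p => ?_
    simp
  rw [h4, Measure.volume_eq_prod, lintegral_prod_symm' _ hg]
  refine lintegral_congr fun y => ?_
  have hy : Measurable fun x : S => f ((x : V) + y) :=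
    hg.comp (measurable_id.prodMk measurable_const)
  refine (h3.lintegral_comp hy).symm.trans ?_
  refine lintegral_congr fun t => ?_
  rw [add_comm]
  rfl

/-- The slope cone is sliced over `v^⊥` and the cap over the hyperplane of a boundary chart; this
identifies the two constants so that they cancel in the end. -/
lemma volume_ball_orthogonal_eq {V : Type*} [NormedAddCommGroup V] [InnerProductSpace ℝ V]
    [FiniteDimensional ℝ V] [MeasurableSpace V] [BorelSpace V] {e v : V} (he : e ≠ 0) (hv : v ≠ 0)
    (r : ℝ) :
    volume (ball (0 : (Submodule.span ℝ {e})ᗮ) r) =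
      volume (ball (0 : (Submodule.span ℝ {v})ᗮ) r) := by
  have h : Module.finrank ℝ (Submodule.span ℝ {e})ᗮ = Module.finrank ℝ (Submodule.span ℝ {v})ᗮ := by
    have h1 := (Submodule.span ℝ {e}).finrank_add_finrank_orthogonal
    have h2 := (Submodule.span ℝ {v}).finrank_add_finrank_orthogonal
    rw [finrank_span_singleton he] at h1
    rw [finrank_span_singleton hv] at h2
    omega
  let φ := (stdOrthonormalBasis ℝ (Submodule.span ℝ {e})ᗮ).equiv
    (stdOrthonormalBasis ℝ (Submodule.span ℝ {v})ᗮ) (finCongr h)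
  rw [← φ.measurePreserving.measure_preimage measurableSet_ball.nullMeasurableSet]
  congr 1
  rw [φ.preimage_ball]
  simp

lemma finrank_orthogonal_span {n : ℕ} {e : E n} (he : e ≠ 0) :
    Module.finrank ℝ (Submodule.span ℝ {e})ᗮ = n - 1 := by
  have h1 := (Submodule.span ℝ {e}).finrank_add_finrank_orthogonal
  rw [finrank_span_singleton he, finrank_euclideanSpace_fin] at h1
  omega

/-- The truncated open cone of height `1`, opening `θ` and axis `-v`. -/
def truncatedCone {n : ℕ} (v : E n) (θ : ℝ) : Set (E n) :=
  {ξ | -1 < ⟪ξ, v⟫_ℝ ∧ ⟪ξ, v⟫_ℝ < 0 ∧ ‖ξ - ⟪ξ, v⟫_ℝ • v‖ < θ * -⟪ξ, v⟫_ℝ}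

lemma measurableSet_truncatedCone {n : ℕ} (v : E n) (θ : ℝ) :
    MeasurableSet (truncatedCone v θ) := by
  have h : Continuous fun ξ : E n => ⟪ξ, v⟫_ℝ := by fun_prop
  exact ((isOpen_lt continuous_const h).inter ((isOpen_lt h continuous_const).inter
    (isOpen_lt (by fun_prop : Continuous fun ξ : E n => ‖ξ - ⟪ξ, v⟫_ℝ • v‖)
      (by fun_prop : Continuous fun ξ : E n => θ * -⟪ξ, v⟫_ℝ)))).measurableSet

lemma lintegral_ofReal_pow_neg (k : ℕ) {b : ℝ} (hb : 0 ≤ b) :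
    ∫⁻ t in Set.Ioo (-b) 0, ENNReal.ofReal ((-t) ^ k) =
      ENNReal.ofReal (b ^ (k + 1) / (k + 1)) := by
  rw [← ofReal_integral_eq_lintegral_ofReal]
  · congr 1
    rw [← integral_Ioc_eq_integral_Ioo, ← intervalIntegral.integral_of_le (by linarith),
      intervalIntegral.integral_comp_neg (fun t => t ^ k)]
    simp
  · exact ((by fun_prop : Continuous fun t : ℝ => (-t) ^ k).integrableOn_Icc
      (a := -b) (b := 0)).mono_set Set.Ioo_subset_Icc_self
  · filter_upwards [ae_restrict_mem measurableSet_Ioo] with t ht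
    exact pow_nonneg (by linarith [ht.2]) _

/-- The slice at height `t ∈ (-1, 0)` is a ball of radius `θ(-t)` in `v^⊥`, and `∫ (-t)^(n-1) =
1/n`. -/
lemma volume_truncatedCone {n : ℕ} (hn : 1 ≤ n) {v : E n} (hv : ‖v‖ = 1) {θ : ℝ} (hθ : 0 < θ) :
    volume (truncatedCone v θ) =
      ENNReal.ofReal (θ ^ (n - 1) / n) * volume (ball (0 : (Submodule.span ℝ {v})ᗮ) 1) := by
  have hm := measurableSet_truncatedCone v θ
  have hv0 : v ≠ 0 := by rintro rfl; simp at hv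
  rw [← lintegral_indicator_one hm,
    lintegral_orthogonal_slices hv (measurable_one.indicator hm), lintegral_lintegral_swap]
  · have key : ∀ t : ℝ, ∫⁻ y : (Submodule.span ℝ {v})ᗮ,
        (truncatedCone v θ).indicator (1 : E n → ℝ≥0∞) (y + t • v) =
        (Set.Ioo (-1 : ℝ) 0).indicator (fun t => ENNReal.ofReal ((-t) ^ (n - 1))) t *
          (ENNReal.ofReal (θ ^ (n - 1)) * volume (ball (0 : (Submodule.span ℝ {v})ᗮ) 1)) := by
      intro t
      have hmem : ∀ y : (Submodule.span ℝ {v})ᗮ, ((y : E n) + t • v ∈ truncatedCone v θ ↔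
          t ∈ Set.Ioo (-1 : ℝ) 0 ∧ y ∈ ball (0 : (Submodule.span ℝ {v})ᗮ) (θ * -t)) := by
        intro y
        have h0 : ⟪(y : E n), v⟫_ℝ = 0 := by
          rw [real_inner_comm]
          exact (Submodule.mem_orthogonal_singleton_iff_inner_right).1 y.2
        have h1 : ⟪(y : E n) + t • v, v⟫_ℝ = t := by
          rw [inner_add_left, h0, inner_smul_left, real_inner_self_eq_norm_sq, hv]; simp
        simp only [truncatedCone, Set.mem_ofPred_eq, h1, add_sub_cancel_right, Set.mem_Ioo,
          mem_ball_zero_iff, Submodule.coe_norm, and_assoc]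
      by_cases ht : t ∈ Set.Ioo (-1 : ℝ) 0
      · have hpos : 0 < θ * -t := mul_pos hθ (by linarith [ht.2])
        have : ∀ y : (Submodule.span ℝ {v})ᗮ,
            (truncatedCone v θ).indicator (1 : E n → ℝ≥0∞) (y + t • v) =
            (ball (0 : (Submodule.span ℝ {v})ᗮ) (θ * -t)).indicator 1 y := by
          intro y
          by_cases hy : y ∈ ball (0 : (Submodule.span ℝ {v})ᗮ) (θ * -t)
          · rw [Set.indicator_of_mem hy, Set.indicator_of_mem ((hmem y).2 ⟨ht, hy⟩)]; rfl
          · rw [Set.indicator_of_notMem hy, Set.indicator_of_notMem fun h => hy ((hmem y).1 h).2]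
        simp_rw [this]
        rw [lintegral_indicator_one measurableSet_ball, Measure.addHaar_ball_of_pos _ _ hpos,
          finrank_orthogonal_span hv0, Set.indicator_of_mem ht, ← mul_assoc,
          ← ENNReal.ofReal_mul (pow_nonneg (by linarith [ht.2]) _), mul_pow, mul_comm (θ ^ _)]
      · have : ∀ y : (Submodule.span ℝ {v})ᗮ,
            (truncatedCone v θ).indicator (1 : E n → ℝ≥0∞) (y + t • v) = 0 := fun y =>
          Set.indicator_of_notMem (fun h => ht ((hmem y).1 h).1) _
        simp [this, Set.indicator_of_notMem ht]
    simp_rw [key]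
    rw [lintegral_mul_const _ (by measurability), lintegral_indicator measurableSet_Ioo,
      lintegral_ofReal_pow_neg _ zero_le_one, ← mul_assoc, ← ENNReal.ofReal_mul (by positivity)]
    congr 2
    rw [← Nat.cast_add_one, Nat.sub_add_cancel hn]
    simp [div_eq_inv_mul]
  · refine ((measurable_one.indicator hm).comp ?_).aemeasurable
    have : Continuous fun p : (Submodule.span ℝ {v})ᗮ × ℝ => (p.1 : E n) + p.2 • v := by fun_prop
    exact this.measurable

/-! ### The gnomonic image of the weighted hemisphere measure. -/

/-- The point `(q, t)` of `ℝⁿ⁺¹`. -/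
def snocE {n : ℕ} (q : E n) (t : ℝ) : E (n + 1) :=
  WithLp.toLp 2 (Fin.snoc (α := fun _ => ℝ) (fun i => q i) t)

@[simp] lemma snocE_last {n : ℕ} (q : E n) (t : ℝ) : snocE q t (Fin.last n) = t := by
  simp [snocE]

@[simp] lemma snocE_castSucc {n : ℕ} (q : E n) (t : ℝ) (i : Fin n) :
    snocE q t i.castSucc = q i := by
  simp [snocE]

lemma norm_snocE_sq {n : ℕ} (q : E n) (t : ℝ) : ‖snocE q t‖ ^ 2 = ‖q‖ ^ 2 + t ^ 2 := by
  simp [EuclideanSpace.norm_sq_eq, Fin.sum_univ_castSucc]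

lemma continuous_snocE {n : ℕ} : Continuous fun p : E n × ℝ => snocE p.1 p.2 := by
  refine (PiLp.continuous_toLp 2 _).comp (continuous_pi fun i => ?_)
  refine Fin.lastCases ?_ (fun j => ?_) i
  · simpa using continuous_snd
  · simp only [Fin.snoc_castSucc]
    fun_prop

lemma lintegral_snocE {n : ℕ} {f : E (n + 1) → ℝ≥0∞} (hf : Measurable f) :
    ∫⁻ x, f x = ∫⁻ t : ℝ, ∫⁻ q : E n, f (snocE q t) := by
  have h1 := PiLp.volume_preserving_toLp (Fin (n + 1))
  have h2 := (volume_preserving_piFinSuccAbove (fun _ : Fin (n + 1) => ℝ) (Fin.last n)).symm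
  have h3 := h1.comp h2
  rw [← h3.lintegral_comp hf, Measure.volume_eq_prod, lintegral_prod]
  · refine lintegral_congr fun t => ?_
    have hm : Measurable fun q : E n => f (snocE q t) :=
      hf.comp (continuous_snocE.comp (continuous_id.prodMk continuous_const)).measurable
    rw [← (PiLp.volume_preserving_toLp (Fin n)).lintegral_comp hm]
    refine lintegral_congr fun q => ?_
    congr 1
    simp only [Function.comp_apply, snocE]
    congr 1
    exact Fin.insertNth_last' t q
  · exact (hf.comp h3.measurable).aemeasurable

/-- The gnomonic projection `ȳ ↦ -y / yₙ₊₁`. -/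
def gnomonic {n : ℕ} (x : E (n + 1)) : E n :=
  WithLp.toLp 2 fun i => -(x i.castSucc) / x (Fin.last n)

lemma measurable_gnomonic {n : ℕ} : Measurable (gnomonic (n := n)) := by
  refine (PiLp.continuous_toLp 2 _).measurable.comp (measurable_pi_iff.2 fun i => ?_)
  have h : ∀ j : Fin (n + 1), Measurable fun x : E (n + 1) => x j := fun j =>
    (by fun_prop : Continuous fun x : E (n + 1) => x j).measurable
  exact (h _).neg.div (h _)

lemma gnomonic_smul {n : ℕ} {r : ℝ} (hr : r ≠ 0) (x : E (n + 1)) :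
    gnomonic (r • x) = gnomonic x := by
  ext i
  simp only [gnomonic, PiLp.smul_apply, smul_eq_mul]
  rw [← mul_neg, mul_div_mul_left _ _ hr]

lemma gnomonic_snocE {n : ℕ} (q : E n) {t : ℝ} (ht : t ≠ 0) :
    gnomonic (snocE ((-t) • q) t) = q := by
  ext i
  simp only [gnomonic, snocE_castSucc, snocE_last, PiLp.smul_apply, smul_eq_mul]
  field_simp

/-- The density of the gnomonic image of the measure `-yₙ₊₁ dVol` on the lower hemisphere. -/
def gnomonicDensity {n : ℕ} (q : E n) : ℝ := (√(1 + ‖q‖ ^ 2))⁻¹ ^ (n + 2)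

lemma measurable_lastCoord {n : ℕ} : Measurable (lastCoord (n := n)) := by
  have : Continuous (lastCoord (n := n)) := by unfold lastCoord; fun_prop
  exact this.measurable

lemma measurableSet_lowerHemisphere (n : ℕ) : MeasurableSet (lowerHemisphere n) :=
  measurableSet_lt measurable_lastCoord measurable_const

/-- The radial factor `∫₀¹ r · rⁿ dr`, one `r` coming from the weight and `rⁿ` from polar
coordinates. -/
lemma lintegral_volumeIoiPow_indicator (n : ℕ) :
    ∫⁻ r : Set.Ioi (0 : ℝ), (Set.Iio (1 : ℝ)).indicator (fun r => ENNReal.ofReal r) r.1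
      ∂(Measure.volumeIoiPow n) = ENNReal.ofReal (1 / (n + 2)) := by
  have h := Measure.volumeIoiPow_apply_Iio (n + 1) ⟨1, Set.mem_Ioi.2 one_pos⟩
  have hc : ∀ k : ℕ, Measurable fun r : Set.Ioi (0 : ℝ) => ENNReal.ofReal (r.1 ^ k) := fun k => by
    fun_prop
  rw [Measure.volumeIoiPow, withDensity_apply _ measurableSet_Iio,
    ← lintegral_indicator measurableSet_Iio] at h
  rw [Measure.volumeIoiPow, lintegral_withDensity_eq_lintegral_mul _ (hc n)]
  · rw [one_pow, Nat.cast_add_one, add_assoc, one_add_one_eq_two] at h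
    rw [← h]
    refine lintegral_congr fun r => ?_
    by_cases hr : r.1 < 1
    · have h1 : r ∈ Set.Iio (⟨1, Set.mem_Ioi.2 one_pos⟩ : Set.Ioi (0 : ℝ)) := hr
      rw [Pi.mul_apply, Set.indicator_of_mem (Set.mem_Iio.2 hr), Set.indicator_of_mem h1,
        ← ENNReal.ofReal_mul (pow_nonneg (le_of_lt r.2) _), pow_succ]
    · have h1 : r ∉ Set.Iio (⟨1, Set.mem_Ioi.2 one_pos⟩ : Set.Ioi (0 : ℝ)) := hr
      rw [Pi.mul_apply, Set.indicator_of_notMem (fun h => hr (Set.mem_Iio.1 h)),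
        Set.indicator_of_notMem h1, mul_zero]
  · exact (ENNReal.measurable_ofReal.indicator measurableSet_Iio).comp measurable_subtype_coe

/-- The weight on `ℝⁿ⁺¹` whose integral is computed in polar and in gnomonic coordinates. -/
def halfBallWeight {n : ℕ} (g : E n → ℝ≥0∞) (x : E (n + 1)) : ℝ≥0∞ :=
  {x : E (n + 1) | ‖x‖ < 1 ∧ x (Fin.last n) < 0}.indicator
    (fun x => ENNReal.ofReal (-x (Fin.last n)) * g (gnomonic x)) x

lemma measurable_halfBallWeight {n : ℕ} {g : E n → ℝ≥0∞} (hg : Measurable g) :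
    Measurable (halfBallWeight g) := by
  have h : Continuous fun x : E (n + 1) => x (Fin.last n) := by fun_prop
  refine Measurable.indicator ?_ ?_
  · exact (ENNReal.measurable_ofReal.comp h.measurable.neg).mul (hg.comp measurable_gnomonic)
  · exact ((isOpen_lt continuous_norm continuous_const).inter
      (isOpen_lt h continuous_const)).measurableSet

/-- The last coordinate is homogeneous of degree one and `gnomonic` of degree zero, so the weight
splits into a spherical and a radial factor. -/
lemma lintegral_halfBallWeight_polar {n : ℕ} {g : E n → ℝ≥0∞} (hg : Measurable g) :
    ∫⁻ x, halfBallWeight g x =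
      (∫⁻ y in lowerHemisphere n, ENNReal.ofReal (-lastCoord y) * g (gnomonic (y : E (n + 1)))
        ∂(sphereVolume n)) * ENNReal.ofReal (1 / (n + 2)) := by
  have hF := measurable_halfBallWeight hg
  have hp := (volume : Measure (E (n + 1))).measurePreserving_homeomorphUnitSphereProd
  rw [finrank_euclideanSpace_fin, Nat.add_sub_cancel] at hp
  have h0 : ∫⁻ x, halfBallWeight g x = ∫⁻ x in ({0}ᶜ : Set (E (n + 1))), halfBallWeight g x := by
    rw [restrict_compl_singleton]
  rw [h0, ← lintegral_subtype_comap (measurableSet_singleton _).compl]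
  have hm1 : Measurable fun y : Sph n => (lowerHemisphere n).indicator
      (fun y => ENNReal.ofReal (-lastCoord y) * g (gnomonic (y : E (n + 1)))) y :=
    Measurable.indicator ((ENNReal.measurable_ofReal.comp measurable_lastCoord.neg).mul
      (hg.comp (measurable_gnomonic.comp measurable_subtype_coe))) (measurableSet_lowerHemisphere n)
  have hm2 : Measurable fun r : Set.Ioi (0 : ℝ) =>
      (Set.Iio (1 : ℝ)).indicator (fun r => ENNReal.ofReal r) r.1 :=
    (ENNReal.measurable_ofReal.indicator measurableSet_Iio).comp measurable_subtype_coe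
  rw [← lintegral_indicator (measurableSet_lowerHemisphere n), ← lintegral_volumeIoiPow_indicator,
    ← lintegral_prod_mul hm1.aemeasurable hm2.aemeasurable]
  have hm3 : Measurable fun z : Sph n × Set.Ioi (0 : ℝ) => (lowerHemisphere n).indicator
      (fun y => ENNReal.ofReal (-lastCoord y) * g (gnomonic (y : E (n + 1)))) z.1 *
      (Set.Iio (1 : ℝ)).indicator (fun r => ENNReal.ofReal r) z.2.1 :=
    (hm1.comp measurable_fst).mul (hm2.comp measurable_snd)
  refine Eq.trans ?_ (hp.lintegral_comp hm3)
  refine lintegral_congr fun x => ?_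
  obtain ⟨⟨y, r⟩, rfl⟩ := (homeomorphUnitSphereProd (E (n + 1))).symm.surjective x
  have hr : 0 < r.1 := r.2
  have hx := homeomorphUnitSphereProd_symm_apply_coe (E (n + 1)) (y, r)
  rw [Homeomorph.apply_symm_apply]
  set x := (homeomorphUnitSphereProd (E (n + 1))).symm (y, r)
  have hnorm : ‖(x : E (n + 1))‖ = r.1 := by
    rw [hx, norm_smul, norm_eq_of_mem_sphere y, mul_one, Real.norm_of_nonneg hr.le]
  have hlast : (x : E (n + 1)) (Fin.last n) = r.1 * lastCoord y := by
    rw [hx]; rfl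
  simp only [halfBallWeight, Set.indicator_apply, Set.mem_ofPred_eq, hnorm, hlast, Set.mem_Iio,
    lowerHemisphere, mul_neg_iff, hr, not_lt_of_gt hr, true_and, false_and, or_false]
  rw [hx, gnomonic_smul hr.ne']
  by_cases h1 : r.1 < 1 <;> by_cases h2 : lastCoord y < 0 <;>
    simp only [h1, h2, and_true, if_true, if_false, and_false, mul_zero, zero_mul]
  rw [neg_mul_eq_mul_neg, ENNReal.ofReal_mul hr.le]
  ring

lemma lintegral_comp_smul {n : ℕ} {r : ℝ} (hr : 0 < r) {f : E n → ℝ≥0∞} (hf : Measurable f) :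
    ∫⁻ q, f q = ENNReal.ofReal (r ^ n) * ∫⁻ q, f (r • q) := by
  have h := Measure.map_addHaar_smul (volume : Measure (E n)) hr.ne'
  have h1 : ∫⁻ q, f (r • q) = ENNReal.ofReal (r ^ n)⁻¹ * ∫⁻ q, f q := by
    rw [← lintegral_map hf (measurable_const_smul r), h, lintegral_smul_measure,
      finrank_euclideanSpace_fin, abs_of_pos (by positivity), smul_eq_mul]
  rw [h1, ← mul_assoc, ← ENNReal.ofReal_mul (by positivity),
    mul_inv_cancel₀ (by positivity), ENNReal.ofReal_one, one_mul]

/-- At height `t` the substitution `q ↦ (-t q, t)` has Jacobian `(-t)ⁿ`, so the weight becomes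
`(-t)^(n+1) g(q)`. The unit ball restricts `t` to `(-b, 0)` with `b = (1 + |q|²)^(-1/2)`, and the
`t`-integral is `b^(n+2)/(n+2)`. -/
lemma lintegral_halfBallWeight_gnomonic {n : ℕ} {g : E n → ℝ≥0∞} (hg : Measurable g) :
    ∫⁻ x, halfBallWeight g x =
      (∫⁻ q, ENNReal.ofReal (gnomonicDensity q) * g q) * ENNReal.ofReal (1 / (n + 2)) := by
  have hF := measurable_halfBallWeight hg
  let H : E n → ℝ → ℝ≥0∞ := fun q t => g q *
    {t : ℝ | t < 0 ∧ t ^ 2 * (1 + ‖q‖ ^ 2) < 1}.indicator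
      (fun t => ENNReal.ofReal ((-t) ^ (n + 1))) t
  have hH : Measurable fun p : ℝ × E n => H p.2 p.1 := by
    refine (hg.comp measurable_snd).mul ?_
    have : MeasurableSet {p : ℝ × E n | p.1 < 0 ∧ p.1 ^ 2 * (1 + ‖p.2‖ ^ 2) < 1} :=
      ((isOpen_lt continuous_fst continuous_const).inter
        (isOpen_lt (by fun_prop : Continuous fun p : ℝ × E n => p.1 ^ 2 * (1 + ‖p.2‖ ^ 2))
          continuous_const)).measurableSet
    exact Measurable.indicator (f := fun p : ℝ × E n => ENNReal.ofReal ((-p.1) ^ (n + 1)))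
      (by fun_prop) this
  rw [lintegral_snocE hF]
  have h1 : ∀ t : ℝ, ∫⁻ q : E n, halfBallWeight g (snocE q t) = ∫⁻ q : E n, H q t := by
    intro t
    by_cases ht : t < 0
    · have hm : Measurable fun q : E n => halfBallWeight g (snocE q t) :=
        hF.comp (continuous_snocE.comp (continuous_id.prodMk continuous_const)).measurable
      have hm' : Measurable fun q : E n => halfBallWeight g (snocE ((-t) • q) t) :=
        hm.comp (measurable_const_smul _)
      rw [lintegral_comp_smul (neg_pos.2 ht) hm, ← lintegral_const_mul _ hm']
      refine lintegral_congr fun q => ?_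
      have hn : ‖snocE ((-t) • q) t‖ < 1 ↔ t ^ 2 * (1 + ‖q‖ ^ 2) < 1 := by
        rw [← sq_lt_one_iff₀ (norm_nonneg _), norm_snocE_sq, norm_smul, mul_pow, Real.norm_eq_abs,
          sq_abs]
        ring_nf
      simp only [halfBallWeight, H, Set.indicator_apply, Set.mem_ofPred_eq, hn, snocE_last, ht,
        gnomonic_snocE q ht.ne, and_true, true_and]
      split_ifs with h
      · rw [← mul_assoc, ← ENNReal.ofReal_mul (pow_nonneg (by linarith) _), ← pow_succ, mul_comm]
      · simp
    · simp [halfBallWeight, H, ht]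
  simp_rw [h1]
  rw [lintegral_lintegral_swap hH.aemeasurable, ← lintegral_mul_const]
  · refine lintegral_congr fun q => ?_
    set b := (√(1 + ‖q‖ ^ 2))⁻¹ with hb
    have hs : 0 < √(1 + ‖q‖ ^ 2) := Real.sqrt_pos.2 (by positivity)
    have hb0 : 0 < b := inv_pos.2 hs
    have hb2 : b ^ 2 * (1 + ‖q‖ ^ 2) = 1 := by
      rw [hb, inv_pow, Real.sq_sqrt (by positivity), inv_mul_cancel₀ (by positivity)]
    have hset : {t : ℝ | t < 0 ∧ t ^ 2 * (1 + ‖q‖ ^ 2) < 1} = Set.Ioo (-b) 0 := by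
      ext t
      have hq : 0 < 1 + ‖q‖ ^ 2 := by positivity
      simp only [Set.mem_ofPred_eq, Set.mem_Ioo]
      rw [and_comm]
      refine and_congr_left fun ht => ?_
      nth_rewrite 2 [← hb2]
      rw [mul_lt_mul_iff_left₀ hq, sq_lt_sq, abs_of_neg ht, abs_of_pos hb0]
      exact neg_lt
    have hi : Measurable (Set.indicator {t : ℝ | t < 0 ∧ t ^ 2 * (1 + ‖q‖ ^ 2) < 1}
        (fun t => ENNReal.ofReal ((-t) ^ (n + 1)))) := by
      rw [hset]
      exact Measurable.indicator (by fun_prop) measurableSet_Ioo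
    simp only [H]
    rw [lintegral_const_mul _ hi, hset, lintegral_indicator measurableSet_Ioo,
      lintegral_ofReal_pow_neg _ hb0.le, mul_comm, mul_right_comm,
      ← ENNReal.ofReal_mul (by unfold gnomonicDensity; positivity)]
    congr 2
    rw [gnomonicDensity, mul_one_div]
    push_cast
    rw [add_assoc (n : ℝ), one_add_one_eq_two]
  · have : Measurable fun q : E n => gnomonicDensity q := by
      unfold gnomonicDensity
      fun_prop
    exact (ENNReal.measurable_ofReal.comp this).mul hg

/-- The gnomonic projection maps `-yₙ₊₁ dVol` on the lower hemisphere to the measure with density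
`(1 + |q|²) ^ (-(n + 2) / 2)`. -/
lemma lintegral_lowerHemisphere_gnomonic {n : ℕ} {g : E n → ℝ≥0∞} (hg : Measurable g) :
    ∫⁻ y in lowerHemisphere n, ENNReal.ofReal (-lastCoord y) * g (gnomonic (y : E (n + 1)))
        ∂(sphereVolume n) = ∫⁻ q, ENNReal.ofReal (gnomonicDensity q) * g q := by
  have h := (lintegral_halfBallWeight_polar hg).symm.trans (lintegral_halfBallWeight_gnomonic hg)
  refine (ENNReal.mul_left_inj ?_ ENNReal.ofReal_ne_top).1 h
  exact (ENNReal.ofReal_pos.2 (by positivity)).ne'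

lemma hasDerivAt_div_sqrt_one_add_sq (r : ℝ) :
    HasDerivAt (fun r : ℝ => r * (√(1 + r ^ 2))⁻¹) ((√(1 + r ^ 2))⁻¹ ^ 3) r := by
  have hpos : 0 < 1 + r ^ 2 := by positivity
  have hs : 0 < √(1 + r ^ 2) := Real.sqrt_pos.2 hpos
  have h1 : HasDerivAt (fun r : ℝ => 1 + r ^ 2) (2 * r) r := by
    simpa using (hasDerivAt_pow 2 r).const_add 1
  have h2 := (hasDerivAt_id r).mul ((h1.sqrt hpos.ne').inv hs.ne')
  refine h2.congr_deriv ?_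
  have h3 : √(1 + r ^ 2) ^ 2 = 1 + r ^ 2 := Real.sq_sqrt hpos.le
  simp only [id, Pi.inv_apply]
  field_simp
  linarith

lemma tendsto_div_sqrt_one_add_sq :
    Tendsto (fun r : ℝ => r * (√(1 + r ^ 2))⁻¹) atTop (𝓝 1) := by
  have h1 : Tendsto (fun r : ℝ => √(1 - (1 + r ^ 2)⁻¹)) atTop (𝓝 1) := by
    have h2 : Tendsto (fun r : ℝ => (1 + r ^ 2)⁻¹) atTop (𝓝 0) :=
      tendsto_inv_atTop_zero.comp
        (tendsto_atTop_add_const_left _ _ (tendsto_pow_atTop two_ne_zero))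
    have h3 := (h2.const_sub 1).sqrt
    simpa using h3
  refine h1.congr' ?_
  filter_upwards [eventually_gt_atTop 0] with r hr
  have hpos : 0 < 1 + r ^ 2 := by positivity
  have h : 1 - (1 + r ^ 2)⁻¹ = (r * (√(1 + r ^ 2))⁻¹) ^ 2 := by
    rw [mul_pow, inv_pow, Real.sq_sqrt hpos.le]
    field_simp
    ring
  rw [h, Real.sqrt_sq (by positivity)]

/-- In polar coordinates the radial integrand has the primitive `(r/√(1+r²))ⁿ/n`, which tends to
`1/n`. -/
lemma lintegral_gnomonicDensity {n : ℕ} (hn : 1 ≤ n) :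
    ∫⁻ q : E n, ENNReal.ofReal (gnomonicDensity q) = volume (ball (0 : E n) 1) := by
  have : Nonempty (Fin n) := ⟨⟨0, hn⟩⟩
  have hn0 : (n : ℝ) ≠ 0 := by positivity
  let F : ℝ → ℝ := fun r => (r * (√(1 + r ^ 2))⁻¹) ^ n / n
  let F' : ℝ → ℝ := fun r => r ^ (n - 1) • (√(1 + r ^ 2))⁻¹ ^ (n + 2)
  have hd : ∀ r ∈ Set.Ici (0 : ℝ), HasDerivAt F (F' r) r := by
    intro r _
    refine (((hasDerivAt_div_sqrt_one_add_sq r).pow n).div_const (n : ℝ)).congr_deriv ?_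
    obtain ⟨m, rfl⟩ : ∃ m, n = m + 1 := ⟨n - 1, by omega⟩
    simp only [F', Nat.add_sub_cancel, smul_eq_mul]
    generalize (√(1 + r ^ 2))⁻¹ = s
    field_simp
    ring
  have h0 : ∀ r ∈ Set.Ioi (0 : ℝ), 0 ≤ F' r := fun r hr => by
    have : 0 < r := hr
    simp only [F', smul_eq_mul]
    positivity
  have ht : Tendsto F atTop (𝓝 (1 / n)) := by
    simpa using (tendsto_div_sqrt_one_add_sq.pow n).div_const (n : ℝ)
  have hi : IntegrableOn F' (Set.Ioi 0) := integrableOn_Ioi_deriv_of_nonneg' hd h0 ht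
  have hint : ∫ r in Set.Ioi (0 : ℝ), F' r = 1 / n := by
    rw [integral_Ioi_of_hasDerivAt_of_nonneg' hd h0 ht]
    simp [F, zero_pow (show n ≠ 0 by omega)]
  have hrad := integral_fun_norm_addHaar (volume : Measure (E n))
    (fun r : ℝ => (√(1 + r ^ 2))⁻¹ ^ (n + 2))
  have hradi := (integrable_fun_norm_addHaar (volume : Measure (E n))
    (f := fun r : ℝ => (√(1 + r ^ 2))⁻¹ ^ (n + 2))).2 (by rwa [finrank_euclideanSpace_fin])
  rw [finrank_euclideanSpace_fin, hint] at hrad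
  unfold gnomonicDensity
  rw [← ofReal_integral_eq_lintegral_ofReal hradi (Eventually.of_forall fun q => by positivity),
    hrad, nsmul_eq_mul, smul_eq_mul, mul_comm (Measure.real _ _), ← mul_assoc,
    mul_one_div_cancel hn0, one_mul, ofReal_measureReal]

/-- This is where critical mass enters: the whole hemisphere has weighted mass `ωₙ`, so its part
outside `Ωs` is null and no slope is missed. -/
lemma le_targetMeasure_gnomonic {n : ℕ} (hn : 1 ≤ n) {Ωs : Set (Sph n)}
    (hΩsm : MeasurableSet Ωs) (hΩs : Ωs ⊆ lowerHemisphere n)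
    (hmass : ∫⁻ y in Ωs, ENNReal.ofReal (-lastCoord y) ∂(sphereVolume n) =
      volume (ball (0 : E n) 1)) {D : Set (E n)} (hD : MeasurableSet D) :
    ∫⁻ q in D, ENNReal.ofReal (gnomonicDensity q) ≤
      targetMeasure Ωs {y | y ∈ lowerHemisphere n ∧ gnomonic (y : E (n + 1)) ∈ D} := by
  set κ := (sphereVolume n).withDensity fun y => ENNReal.ofReal (-lastCoord y) with hκ
  have hlow := measurableSet_lowerHemisphere n
  have hG : MeasurableSet {y : Sph n | gnomonic (y : E (n + 1)) ∈ D} :=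
    (measurable_gnomonic.comp measurable_subtype_coe) hD
  have hB : MeasurableSet {y : Sph n | y ∈ lowerHemisphere n ∧ gnomonic (y : E (n + 1)) ∈ D} :=
    hlow.inter hG
  have h1 : κ (lowerHemisphere n) = volume (ball (0 : E n) 1) := by
    rw [hκ, withDensity_apply _ hlow, ← lintegral_gnomonicDensity hn]
    simpa using lintegral_lowerHemisphere_gnomonic (n := n) (g := 1) measurable_one
  have h2 : κ Ωs = volume (ball (0 : E n) 1) := by rw [hκ, withDensity_apply _ hΩsm, hmass]
  have h3 : κ (lowerHemisphere n \ Ωs) = 0 := by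
    rw [measure_sdiff hΩs hΩsm.nullMeasurableSet (by rw [h2]; exact measure_ball_lt_top.ne), h1, h2,
      tsub_self]
  have h4 : κ {y | y ∈ lowerHemisphere n ∧ gnomonic (y : E (n + 1)) ∈ D} =
      ∫⁻ q in D, ENNReal.ofReal (gnomonicDensity q) := by
    have := lintegral_lowerHemisphere_gnomonic (n := n) (g := D.indicator 1)
      (measurable_one.indicator hD)
    rw [hκ, withDensity_apply _ hB, ← lintegral_indicator hD, ← lintegral_indicator hB]
    rw [← lintegral_indicator hlow] at this
    refine (Eq.trans (lintegral_congr fun y => ?_) this).trans (lintegral_congr fun q => ?_)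
    · by_cases h1 : y ∈ lowerHemisphere n <;> by_cases h2 : gnomonic (y : E (n + 1)) ∈ D <;>
        simp [h1, h2]
    · by_cases h : q ∈ D <;> simp [h]
  rw [← h4]
  have h5 : targetMeasure Ωs = κ.restrict Ωs := (restrict_withDensity hΩsm _).symm
  rw [h5, Measure.restrict_apply hB, ← measure_inter_add_sdiff _ hΩsm]
  refine (add_le_add_right (measure_mono (Set.sdiff_subset_sdiff_left fun y hy => hy.1)) _).trans ?_
  rw [h3, add_zero]

/-! ### Geometry of the enclosing ball near a boundary point. -/

section Boundary

variable {n : ℕ} {Ω : Set (E n)}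

lemma bdist_le_dist_of_notMem {x w : E n} (hx : x ∈ Ω) (hw : w ∉ Ω) : bdist Ω x ≤ dist x w := by
  obtain ⟨y, hy, hxy⟩ := exists_mem_frontier_infDist_compl_eq_dist hx fun h => hw (h ▸ Set.mem_univ w)
  calc bdist Ω x ≤ dist x y := infDist_le_dist_of_mem hy
    _ = infDist x Ωᶜ := hxy.symm
    _ ≤ dist x w := infDist_le_dist_of_mem hw

lemma ball_bdist_subset {x : E n} (hx : x ∈ Ω) : ball x (bdist Ω x) ⊆ Ω := fun w hw => by
  by_contra h
  exact (bdist_le_dist_of_notMem hx h).not_gt (by rwa [dist_comm])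

lemma notMem_of_mem_frontier (hΩ : IsOpen Ω) {z : E n} (hz : z ∈ frontier Ω) : z ∉ Ω := by
  rw [hΩ.frontier_eq] at hz
  exact hz.2

lemma ne_univ_of_isBounded (hn : 1 ≤ n) (hb : Bornology.IsBounded Ω) : Ω ≠ Set.univ := by
  rintro rfl
  have : Nonempty (Fin n) := ⟨⟨0, hn⟩⟩
  exact NormedSpace.unbounded_univ ℝ (E n) hb

lemma exists_frontier_bdist_eq (hn : 1 ≤ n) (hb : Bornology.IsBounded Ω) {x : E n} (hx : x ∈ Ω) :
    ∃ z ∈ frontier Ω, bdist Ω x = dist x z :=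
  isClosed_frontier.exists_infDist_eq_dist
    (nonempty_frontier_iff.2 ⟨⟨x, hx⟩, ne_univ_of_isBounded hn hb⟩) x

lemma bdist_pos (hn : 1 ≤ n) (hΩ : IsOpen Ω) (hb : Bornology.IsBounded Ω) {x : E n} (hx : x ∈ Ω) :
    0 < bdist Ω x := by
  obtain ⟨z, hz, h⟩ := exists_frontier_bdist_eq hn hb hx
  rw [h, dist_pos]
  rintro rfl
  exact notMem_of_mem_frontier hΩ hz hx

/-- A ball inside an enclosing ball, touching it at `z`, has its centre on the radius to `z`. -/
lemma sub_smul_eq_of_ball_subset_ball {V : Type*} [NormedAddCommGroup V] [InnerProductSpace ℝ V]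
    {c x z : V} {R d : ℝ} (hd : 0 < d) (hR : 0 < R) (hsub : ball x d ⊆ ball c R)
    (hxz : dist x z = d) (hcz : dist z c = R) :
    d ≤ R ∧ R • (x - z) = d • (c - z) := by
  have hle : ‖x - c‖ ≤ R - d := by
    by_contra! hlt
    rcases eq_or_ne x c with rfl | hne
    · rw [dist_comm] at hcz
      simp [← hcz, ← hxz] at hlt
    · have hpos : 0 < ‖x - c‖ := norm_pos_iff.2 (sub_ne_zero.2 hne)
      -- Moving from `x` away from `c` by `s < d` stays in the small ball but reaches distance at
      -- least `R` from `c`.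
      set s := max 0 (R - ‖x - c‖) with hs
      have hs0 : 0 ≤ s := le_max_left _ _
      have hsd : s < d := max_lt hd (by linarith)
      have hmem : x + (s / ‖x - c‖) • (x - c) ∈ ball x d := by
        rw [mem_ball_iff_norm, add_sub_cancel_left, norm_smul, Real.norm_of_nonneg (by positivity),
          div_mul_cancel₀ _ hpos.ne']
        exact hsd
      have h2 := hsub hmem
      rw [mem_ball_iff_norm, show x + (s / ‖x - c‖) • (x - c) - c =
        (1 + s / ‖x - c‖) • (x - c) by module, norm_smul, Real.norm_of_nonneg (by positivity),
        add_mul, one_mul, div_mul_cancel₀ _ hpos.ne'] at h2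
      linarith [le_max_right 0 (R - ‖x - c‖)]
  refine ⟨by linarith [norm_nonneg (x - c)], ?_⟩
  rw [dist_eq_norm] at hxz
  rw [dist_comm, dist_eq_norm] at hcz
  have h1 : ‖x - c‖ ^ 2 = d ^ 2 - 2 * ⟪x - z, c - z⟫_ℝ + R ^ 2 := by
    rw [← hxz, ← hcz, ← norm_sub_sq_real, sub_sub_sub_cancel_right]
  have h2 : ‖x - c‖ ^ 2 ≤ (R - d) ^ 2 := pow_le_pow_left₀ (norm_nonneg _) hle 2
  -- `h1` and `h2` give `R d ≤ ⟪x - z, c - z⟫`, the equality case of Cauchy–Schwarz.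
  have h3 : ‖R • (x - z) - d • (c - z)‖ ^ 2 ≤ 0 := by
    rw [norm_sub_sq_real, norm_smul, norm_smul, hxz, hcz, inner_smul_left, inner_smul_right,
      Real.norm_of_nonneg hd.le, Real.norm_of_nonneg hR.le]
    simp only [conj_trivial]
    nlinarith [mul_pos hd hR]
  rw [← sub_eq_zero, ← norm_eq_zero]
  exact pow_eq_zero_iff two_ne_zero |>.1 (le_antisymm h3 (sq_nonneg _))

/-- Expanding `|x - c| < R` about `z` gives `|x - z|² < 2⟪x - z, c - z⟫`, and `c - z` is `R/d` times
`x₀ - z`. The inner product is positive, so `R` may be enlarged to `R₀`. -/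
lemma enclosing_ball_estimate (hn : 1 ≤ n) (hΩ : IsOpen Ω) (hb : Bornology.IsBounded Ω) {R₀ : ℝ}
    (hball : EnclosingBallCondition Ω R₀) {x₀ z : E n} (hx₀ : x₀ ∈ Ω) (hz : z ∈ frontier Ω)
    (hd : bdist Ω x₀ = dist x₀ z) :
    bdist Ω x₀ ≤ R₀ ∧
      ∀ x ∈ Ω, bdist Ω x₀ * ‖x - z‖ ^ 2 < 2 * R₀ * ⟪x - z, x₀ - z⟫_ℝ := by
  obtain ⟨c, R, hR, hRR, hsub, hzc⟩ := hball z hz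
  have hpos := bdist_pos hn hΩ hb hx₀
  obtain ⟨hdR, hcol⟩ := sub_smul_eq_of_ball_subset_ball hpos hR
    ((ball_bdist_subset hx₀).trans hsub) hd.symm hzc
  refine ⟨hdR.trans hRR, fun x hx => ?_⟩
  have hxc := hsub hx
  rw [mem_ball_iff_norm] at hxc
  rw [mem_sphere, dist_comm, dist_eq_norm] at hzc
  have h1 : ‖x - c‖ ^ 2 < R ^ 2 := pow_lt_pow_left₀ hxc (norm_nonneg _) two_ne_zero
  rw [← sub_sub_sub_cancel_right x c z, norm_sub_sq_real, hzc] at h1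
  have h2 : ⟪x - z, R • (x₀ - z)⟫_ℝ = ⟪x - z, bdist Ω x₀ • (c - z)⟫_ℝ := by rw [hcol]
  rw [inner_smul_right, inner_smul_right] at h2
  have h3 : bdist Ω x₀ * ‖x - z‖ ^ 2 < 2 * (R * ⟪x - z, x₀ - z⟫_ℝ) := by
    rw [h2]
    nlinarith
  have h4 : 0 < R * ⟪x - z, x₀ - z⟫_ℝ := by
    have : 0 ≤ bdist Ω x₀ * ‖x - z‖ ^ 2 := by positivity
    linarith
  have h5 := pos_of_mul_pos_right h4 hR.le
  nlinarith

/-- Points of `Ω` on the far side of `x₀` with respect to a direction close to the outward normal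
lie in a small cap. -/
lemma mem_cap_of_inner_nonneg (hn : 1 ≤ n) (hΩ : IsOpen Ω) (hb : Bornology.IsBounded Ω) {R₀ m : ℝ}
    (hR₀ : 0 < R₀) (hball : EnclosingBallCondition Ω R₀) {x₀ z : E n} (hx₀ : x₀ ∈ Ω)
    (hz : z ∈ frontier Ω) (hd : bdist Ω x₀ = dist x₀ z) (hm : 0 < m)
    (hm2 : m ^ 2 = R₀ * bdist Ω x₀) {ξ x : E n}
    (hξ : ξ ∈ truncatedCone ((bdist Ω x₀)⁻¹ • (x₀ - z)) (bdist Ω x₀ / (2 * m)))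
    (hx : x ∈ Ω) (hinner : 0 ≤ ⟪ξ, x - x₀⟫_ℝ) :
    ‖x - z‖ < 2 * m ∧ bdist Ω x < 2 * bdist Ω x₀ := by
  obtain ⟨-, henc⟩ := enclosing_ball_estimate hn hΩ hb hball hx₀ hz hd
  have hpos := bdist_pos hn hΩ hb hx₀
  set d := bdist Ω x₀ with hdd
  set v := d⁻¹ • (x₀ - z) with hv
  have hxz : x₀ - z = d • v := by rw [hv, smul_inv_smul₀ hpos.ne']
  have hvn : ‖v‖ = 1 := by
    rw [hv, norm_smul, norm_inv, Real.norm_of_nonneg hpos.le, ← dist_eq_norm, ← hd,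
      inv_mul_cancel₀ hpos.ne']
  have hvv : ⟪v, v⟫_ℝ = 1 := by rw [real_inner_self_eq_norm_sq, hvn, one_pow]
  have henc' : ∀ w ∈ Ω, ‖w - z‖ ^ 2 < 2 * R₀ * ⟪w - z, v⟫_ℝ := fun w hw => by
    have := henc w hw
    rw [hxz, inner_smul_right] at this
    nlinarith
  set k := ⟪x - z, v⟫_ℝ with hk
  set X := ‖x - z‖ with hX
  have hX0 : 0 ≤ X := norm_nonneg _
  have h1 : X ^ 2 < 2 * R₀ * k := henc' x hx
  have hk0 : 0 < k := by
    have : 0 < 2 * R₀ * k := (sq_nonneg X).trans_lt h1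
    exact pos_of_mul_pos_right this (by positivity)
  obtain ⟨-, hs0, hs⟩ := hξ
  set s := ⟪ξ, v⟫_ℝ with hsdef
  -- Split `ξ` along `v`: its axial part `s` is negative and the rest is shorter than `θ(-s)`, hence
  -- `k - d ≤ θ X` with `θ = d/(2m)`.
  have hkd : d * (2 * m) * (k - d) ≤ d * d * X := by
    have h2 : ⟪ξ, x - x₀⟫_ℝ = s * (k - d) + ⟪ξ - s • v, x - z⟫_ℝ := by
      have e1 : x - x₀ = (x - z) - d • v := by rw [← hxz]; abel
      rw [e1, inner_sub_right, inner_smul_right, inner_sub_left, inner_smul_left,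
        real_inner_comm (x - z) v]
      simp only [conj_trivial]
      ring
    have h3 := real_inner_le_norm (ξ - s • v) (x - z)
    have h4 : ‖ξ - s • v‖ * X ≤ d / (2 * m) * -s * X := by gcongr
    have h5 : 0 ≤ -s * (d / (2 * m) * X - (k - d)) := by
      rw [h2] at hinner
      linarith
    have h6 := nonneg_of_mul_nonneg_right h5 (by linarith)
    have h7 : k - d ≤ d * X / (2 * m) := by rw [mul_div_right_comm]; linarith
    rw [le_div_iff₀ (by positivity)] at h7
    nlinarith
  have hkd' : 2 * m * (k - d) ≤ d * X := by nlinarith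
  -- With `m² = R₀d` the two bounds combine to `X² < 2m² + mX`, that is `(X - 2m)(X + m) < 0`.
  have hXm : X < 2 * m := by
    have h8 : m * X ^ 2 < m * (2 * m ^ 2 + m * X) := by
      rw [hm2]
      nlinarith [mul_lt_mul_of_pos_left h1 hm, mul_le_mul_of_nonneg_left hkd' hR₀.le]
    have h9 := lt_of_mul_lt_mul_left h8 hm.le
    by_contra! h
    nlinarith
  refine ⟨hXm, ?_⟩
  -- The projection of `x` to the tangent hyperplane at `z` lies outside `Ω`, so `d(x, ∂Ω) ≤ k ≤ d +
  -- dX/(2m) < 2d`.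
  have hw : x - k • v ∉ Ω := fun hmem => by
    have := henc' _ hmem
    rw [sub_right_comm, inner_sub_left, inner_smul_left, hvv, conj_trivial, mul_one, ← hk, sub_self,
      mul_zero] at this
    exact absurd this (not_lt.2 (sq_nonneg _))
  have hle := bdist_le_dist_of_notMem hx hw
  rw [dist_eq_norm, sub_sub_cancel, norm_smul, hvn, mul_one, Real.norm_of_nonneg hk0.le] at hle
  nlinarith

end Boundary

/-! ### Integrating a power of the boundary distance in Lipschitz coordinates. -/

lemma norm_orthogonal_add_smul_sq {V : Type*} [NormedAddCommGroup V] [InnerProductSpace ℝ V]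
    {e : V} (he : ‖e‖ = 1) (y : (Submodule.span ℝ {e})ᗮ) (t : ℝ) :
    ‖(y : V) + t • e‖ ^ 2 = ‖y‖ ^ 2 + t ^ 2 := by
  have h : ⟪(y : V), e⟫_ℝ = 0 := by
    rw [real_inner_comm]
    exact (Submodule.mem_orthogonal_singleton_iff_inner_right).1 y.2
  rw [norm_add_sq_real, inner_smul_right, h, norm_smul, he]
  simp

lemma norm_le_norm_orthogonal_add_smul {V : Type*} [NormedAddCommGroup V]
    [InnerProductSpace ℝ V] {e : V} (he : ‖e‖ = 1) (y : (Submodule.span ℝ {e})ᗮ) (t : ℝ) :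
    ‖y‖ ≤ ‖(y : V) + t • e‖ ∧ |t| ≤ ‖(y : V) + t • e‖ := by
  have h := norm_orthogonal_add_smul_sq he y t
  refine ⟨abs_le_of_sq_le_sq' ?_ (norm_nonneg _) |>.2, abs_le_of_sq_le_sq ?_ (norm_nonneg _)⟩ <;>
    nlinarith [sq_nonneg t, sq_nonneg ‖y‖]

lemma exists_orthogonal_add_smul {V : Type*} [NormedAddCommGroup V] [InnerProductSpace ℝ V]
    {e : V} (he : ‖e‖ = 1) (x : V) :
    ∃ (y : (Submodule.span ℝ {e})ᗮ) (t : ℝ), x = y + t • e := by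
  refine ⟨⟨x - ⟪e, x⟫_ℝ • e, ?_⟩, ⟪e, x⟫_ℝ, by simp⟩
  rw [Submodule.mem_orthogonal_singleton_iff_inner_right, inner_sub_right, inner_smul_right,
    real_inner_self_eq_norm_sq, he]
  simp

lemma lintegral_Ioo_sub_rpow {δ : ℝ} (hδ1 : δ < 1) (A c : ℝ) (hA : 0 ≤ A) {b : ℝ}
    (hb : 0 ≤ b) :
    ∫⁻ t in Set.Ioo c (c + b), ENNReal.ofReal (A * (t - c) ^ (-δ)) =
      ENNReal.ofReal (A * (b ^ (1 - δ) / (1 - δ))) := by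
  have h0 : ∫⁻ t in Set.Ioo 0 b, ENNReal.ofReal (A * t ^ (-δ)) =
      ENNReal.ofReal (A * (b ^ (1 - δ) / (1 - δ))) := by
    rw [← ofReal_integral_eq_lintegral_ofReal]
    · congr 1
      rw [integral_const_mul, ← integral_Ioc_eq_integral_Ioo, ← intervalIntegral.integral_of_le hb,
        integral_rpow (Or.inl (by linarith)), Real.zero_rpow (by linarith), sub_zero,
        neg_add_eq_sub]
    · refine Integrable.const_mul ?_ _
      have := intervalIntegral.intervalIntegrable_rpow' (a := 0) (b := b) (r := -δ) (by linarith)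
      rw [intervalIntegrable_iff_integrableOn_Ioo_of_le hb] at this
      exact this
    · filter_upwards [ae_restrict_mem measurableSet_Ioo] with t ht
      exact mul_nonneg hA (Real.rpow_nonneg ht.1.le _)
  rw [← h0, ← lintegral_indicator measurableSet_Ioo, ← lintegral_indicator measurableSet_Ioo]
  refine Eq.trans (lintegral_congr fun t => ?_) (lintegral_sub_right_eq_self
    (fun s => (Set.Ioo 0 b).indicator (fun t => ENNReal.ofReal (A * t ^ (-δ))) s) c)
  have : t ∈ Set.Ioo c (c + b) ↔ t - c ∈ Set.Ioo 0 b := by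
    simp only [Set.mem_Ioo, sub_pos, sub_lt_iff_lt_add']
  simp only [Set.indicator_apply, this]

section LipschitzBoundary

variable {n : ℕ} {Ω : Set (E n)}

/-- In Lipschitz coordinates the height over the boundary graph is controlled by the distance to
the boundary. -/
lemma sub_graph_le_mul_bdist (hn : 1 ≤ n) (hΩ : IsOpen Ω) (hb : Bornology.IsBounded Ω)
    {ρ L C₁ : ℝ} (hρ : 0 < ρ) (hL : 0 < L) (hC₁ : 1 < C₁) {a e z : E n}
    {φ : (Submodule.span ℝ {e})ᗮ → ℝ} (he : ‖e‖ = 1)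
    (hφL : ∀ y ∈ ball (0 : (Submodule.span ℝ {e})ᗮ) ρ,
      ∀ w ∈ ball (0 : (Submodule.span ℝ {e})ᗮ) ρ, |φ y - φ w| ≤ L * ‖y - w‖)
    (hgraph : ∀ y ∈ ball (0 : (Submodule.span ℝ {e})ᗮ) ρ, ∀ t : ℝ, |t| < 2 * C₁ * ρ →
      (a + (y : E n) + t • e ∈ Ω ↔ φ y < t))
    {yz : (Submodule.span ℝ {e})ᗮ} (hyz : yz ∈ ball (0 : (Submodule.span ℝ {e})ᗮ) (ρ / 2)) {tz : ℝ}
    (htz : |tz| < C₁ * ρ) (hz : z = a + (yz : E n) + tz • e) {r h : ℝ}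
    (hh : 0 < h) (hrh : r + h ≤ ρ / 2) {y : (Submodule.span ℝ {e})ᗮ} {t : ℝ} (hx : a + (y : E n) + t • e ∈ Ω)
    (hxz : ‖a + (y : E n) + t • e - z‖ < r) (hxh : bdist Ω (a + (y : E n) + t • e) < h) :
    ‖y - yz‖ < r ∧ φ y < t ∧
      t - φ y ≤ (1 + L) ^ (n - 1) * bdist Ω (a + (y : E n) + t • e) := by
  have hCρ : ρ < C₁ * ρ := by nlinarith
  have he0 : e ≠ 0 := by rintro rfl; simp at he
  set x := a + (y : E n) + t • e with hxdef
  have hnear : ∀ (y' : (Submodule.span ℝ {e})ᗮ) (t' s : ℝ),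
      ‖a + (y' : E n) + t' • e - z‖ < s → s ≤ ρ / 2 → ‖y' - yz‖ < s ∧ ‖y'‖ < ρ ∧
        |t'| < 2 * C₁ * ρ := by
    intro y' t' s hs hsρ
    have e1 : a + (y' : E n) + t' • e - z = ((y' - yz : (Submodule.span ℝ {e})ᗮ) : E n) +
        (t' - tz) • e := by
      rw [hz, Submodule.coe_sub]; module
    obtain ⟨h1, h2⟩ := norm_le_norm_orthogonal_add_smul he (y' - yz) (t' - tz)
    rw [← e1] at h1 h2
    rw [mem_ball_zero_iff] at hyz
    refine ⟨by linarith, ?_, ?_⟩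
    · have := norm_add_le (y' - yz) yz
      rw [sub_add_cancel] at this
      linarith
    · have := abs_add_le (t' - tz) tz
      rw [sub_add_cancel] at this
      linarith
  have hD0 : 0 ≤ bdist Ω x := infDist_nonneg
  obtain ⟨w, hw, hxw⟩ := exists_frontier_bdist_eq hn hb hx
  obtain ⟨yw, tw, hwa⟩ := exists_orthogonal_add_smul he (w - a)
  have hw' : w = a + (yw : E n) + tw • e := by
    rw [add_assoc, ← hwa]; abel
  obtain ⟨hy1, hy2, hy3⟩ := hnear y t r hxz (by linarith)
  have hwz : ‖a + (yw : E n) + tw • e - z‖ < r + h := by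
    rw [← hw', ← dist_eq_norm]
    rw [← dist_eq_norm] at hxz
    have := dist_triangle w x z
    rw [dist_comm w x] at this
    linarith
  -- The nearest boundary point `w` is within `r + h ≤ ρ/2` of `z`, hence in the same cylinder.
  obtain ⟨-, hw2, hw3⟩ := hnear yw tw (r + h) hwz hrh
  have hyρ : y ∈ ball (0 : (Submodule.span ℝ {e})ᗮ) ρ := mem_ball_zero_iff.2 hy2
  have hwρ : yw ∈ ball (0 : (Submodule.span ℝ {e})ᗮ) ρ := mem_ball_zero_iff.2 hw2
  have hφt : φ y < t := (hgraph y hyρ t hy3).1 hx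
  have hφw : tw ≤ φ yw := by
    by_contra! hlt
    exact notMem_of_mem_frontier hΩ hw (hw' ▸ (hgraph yw hwρ tw hw3).2 hlt)
  refine ⟨hy1, hφt, ?_⟩
  have hlip := (le_abs_self _).trans (hφL yw hwρ y hyρ)
  have e2 : x - w = ((y - yw : (Submodule.span ℝ {e})ᗮ) : E n) + (t - tw) • e := by
    rw [hw', hxdef, Submodule.coe_sub]; module
  obtain ⟨h1, h2⟩ := norm_le_norm_orthogonal_add_smul he (y - yw) (t - tw)
  rw [← e2, ← dist_eq_norm x w, ← hxw] at h1 h2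
  have h3 := le_abs_self (t - tw)
  rw [norm_sub_rev] at hlip
  -- The height is at most `(1 + L)` times the distance, and `1 + L ≤ (1 + L)^(n-1)` once `n ≥ 2`.
  -- For `n = 1` the hyperplane is a point, the Lipschitz term vanishes and the factor is `1`.
  rcases Nat.lt_or_ge 1 n with h1n | h1n
  · have hM : 1 + L ≤ (1 + L) ^ (n - 1) := le_self_pow₀ (by linarith) (by omega)
    nlinarith [mul_le_mul_of_nonneg_right hM hD0, mul_le_mul_of_nonneg_left h1 hL.le]
  · have hfin : Module.finrank ℝ (Submodule.span ℝ {e})ᗮ = 0 := by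
      rw [finrank_orthogonal_span he0]; omega
    have := Module.finrank_zero_iff.1 hfin
    have hφ : φ y = φ yw := by rw [Subsingleton.elim y yw]
    rw [show n - 1 = 0 by omega, pow_zero, one_mul]
    linarith

lemma measurableSet_cap (hΩ : IsOpen Ω) (z : E n) (r h : ℝ) :
    MeasurableSet {x | x ∈ Ω ∧ ‖x - z‖ < r ∧ bdist Ω x < h} := by
  have h1 : Continuous fun x : E n => ‖x - z‖ := by fun_prop
  have h2 : Continuous (bdist Ω) := continuous_infDist_pt _
  exact (hΩ.inter ((isOpen_lt h1 continuous_const).inter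
    (isOpen_lt h2 continuous_const))).measurableSet

/-- With `M = (1 + L)^(n-1)`, the cap lies at heights below `M h` over the graph, above an
`(n-1)`-ball of radius `r`, and its boundary distance is at least the height over `M`. Each vertical
integral is thus at most `M^δ (M h)^(1-δ)/(1-δ) = M h^(1-δ)/(1-δ)`. -/
lemma setLIntegral_bdist_rpow_le (hn : 1 ≤ n) (hΩ : IsOpen Ω) (hb : Bornology.IsBounded Ω)
    {ρ L C₁ : ℝ} (hlip : IsLipschitzBoundary Ω ρ L C₁) {z v : E n} (hz : z ∈ frontier Ω)
    (hv : v ≠ 0) {r h δ : ℝ} (hr : 0 < r) (hh : 0 < h) (hrh : r + h ≤ ρ / 2) (hδ0 : 0 < δ)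
    (hδ1 : δ < 1) :
    ∫⁻ x in {x | x ∈ Ω ∧ ‖x - z‖ < r ∧ bdist Ω x < h}, ENNReal.ofReal (1 / bdist Ω x ^ δ) ≤
      ENNReal.ofReal (r ^ (n - 1) * ((1 + L) ^ (n - 1) * (h ^ (1 - δ) / (1 - δ)))) *
        volume (ball (0 : (Submodule.span ℝ {v})ᗮ) 1) := by
  obtain ⟨hρ, -, hL, hC₁, hloc⟩ := hlip
  obtain ⟨a, e, φ, he, hφL, -, hgraph, yz, hyz, tz, htz, hzeq⟩ := hloc z hz
  have he0 : e ≠ 0 := by rintro rfl; simp at he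
  set M := (1 + L) ^ (n - 1) with hM
  have hM0 : 0 < M := by positivity
  set S := {x | x ∈ Ω ∧ ‖x - z‖ < r ∧ bdist Ω x < h} with hS
  have hbc : Continuous (bdist Ω) := continuous_infDist_pt _
  have hSm : MeasurableSet S := measurableSet_cap hΩ z r h
  have hfm : Measurable fun x => S.indicator (fun x => ENNReal.ofReal (1 / bdist Ω x ^ δ)) x := by
    refine Measurable.indicator ?_ hSm
    have := hbc.measurable
    fun_prop
  have hfa : Measurable fun x =>
      S.indicator (fun x => ENNReal.ofReal (1 / bdist Ω x ^ δ)) (a + x) :=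
    hfm.comp (measurable_const_add a)
  rw [← lintegral_indicator hSm, ← lintegral_add_left_eq_self _ a,
    lintegral_orthogonal_slices he hfa]
  have key : ∀ (y : (Submodule.span ℝ {e})ᗮ) (t : ℝ),
      S.indicator (fun x => ENNReal.ofReal (1 / bdist Ω x ^ δ)) (a + (y + t • e)) ≤
      (ball yz r).indicator 1 y * (Set.Ioo (φ y) (φ y + M * h)).indicator
        (fun t => ENNReal.ofReal (M ^ δ * (t - φ y) ^ (-δ))) t := by
    intro y t
    rw [← add_assoc]
    by_cases hx : a + (y : E n) + t • e ∈ S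
    · obtain ⟨h1, h2, h3⟩ := sub_graph_le_mul_bdist hn hΩ hb hρ hL hC₁ he hφL hgraph hyz htz hzeq
        hh hrh hx.1 hx.2.1 hx.2.2
      have hpos := bdist_pos hn hΩ hb hx.1
      set D := bdist Ω (a + (y : E n) + t • e) with hD
      have hDh : D < h := hx.2.2
      have ht : t ∈ Set.Ioo (φ y) (φ y + M * h) := ⟨h2, by nlinarith⟩
      rw [Set.indicator_of_mem hx, Set.indicator_of_mem ht,
        Set.indicator_of_mem (mem_ball_iff_norm.2 h1), Pi.one_apply, one_mul]
      apply ENNReal.ofReal_le_ofReal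
      have hpos' : 0 < t - φ y := sub_pos.2 h2
      rw [← hD, Real.rpow_neg hpos'.le, ← div_eq_mul_inv, div_le_div_iff₀ (by positivity)
        (by positivity), one_mul, ← Real.mul_rpow hM0.le hpos.le]
      exact Real.rpow_le_rpow hpos'.le h3 hδ0.le
    · rw [Set.indicator_of_notMem hx]
      exact zero_le
  refine (lintegral_mono fun y => lintegral_mono fun t => key y t).trans ?_
  have hin : ∀ y : (Submodule.span ℝ {e})ᗮ,
      ∫⁻ t, (ball yz r).indicator 1 y * (Set.Ioo (φ y) (φ y + M * h)).indicator
        (fun t => ENNReal.ofReal (M ^ δ * (t - φ y) ^ (-δ))) t =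
      (ball yz r).indicator 1 y * ENNReal.ofReal (M * (h ^ (1 - δ) / (1 - δ))) := by
    intro y
    rw [lintegral_const_mul _ (Measurable.indicator (by fun_prop) measurableSet_Ioo),
      lintegral_indicator measurableSet_Ioo,
      lintegral_Ioo_sub_rpow hδ1 _ _ (by positivity) (by positivity)]
    congr 2
    rw [Real.mul_rpow hM0.le hh.le, mul_div_assoc, ← mul_assoc, ← Real.rpow_add hM0,
      add_sub_cancel, Real.rpow_one]
  simp_rw [hin]
  rw [lintegral_mul_const _ (measurable_one.indicator measurableSet_ball),
    lintegral_indicator_one measurableSet_ball, Measure.addHaar_ball_of_pos _ _ hr,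
    finrank_orthogonal_span he0, volume_ball_orthogonal_eq he0 hv, mul_right_comm,
    ← ENNReal.ofReal_mul (by positivity)]

end LipschitzBoundary

/-! ### Lipschitz charts for a bounded convex open set. -/

section Existence

variable {n : ℕ} {Ω : Set (E n)}

/-- The section of `Ω` in direction `e` over the point `y` of the hyperplane through `z`. -/
def sectionSet (Ω : Set (E n)) (z e y : E n) : Set ℝ := {t | z + y + t • e ∈ Ω}

lemma convex_sectionSet (hΩ : Convex ℝ Ω) (z e y : E n) : Convex ℝ (sectionSet Ω z e y) := by
  intro s hs t ht α β hα hβ hαβ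
  have h := hΩ hs ht hα hβ hαβ
  obtain rfl : β = 1 - α := by linarith
  have e1 : z + y + (α • s + (1 - α) • t) • e =
      α • (z + y + s • e) + (1 - α) • (z + y + t • e) := by
    simp only [smul_eq_mul]; module
  simpa only [sectionSet, Set.mem_ofPred_eq, e1] using h

lemma isOpen_sectionSet (hΩ : IsOpen Ω) (z e y : E n) : IsOpen (sectionSet Ω z e y) :=
  hΩ.preimage (by fun_prop : Continuous fun t : ℝ => z + y + t • e)

/-- The lower end of a section. -/
def sectionInf (Ω : Set (E n)) (z e y : E n) : ℝ := sInf (sectionSet Ω z e y)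

lemma abs_sub_le_of_mem_sectionSet {R : ℝ} (hR : ∀ x ∈ Ω, ∀ y ∈ Ω, dist x y ≤ R) {z e y : E n}
    (he : ‖e‖ = 1) {s t : ℝ} (hs : s ∈ sectionSet Ω z e y) (ht : t ∈ sectionSet Ω z e y) :
    |s - t| ≤ R := by
  have h := hR _ hs _ ht
  rwa [dist_add_left, dist_eq_norm, ← sub_smul, norm_smul, he, mul_one] at h

lemma bddBelow_sectionSet {R : ℝ} (hR : ∀ x ∈ Ω, ∀ y ∈ Ω, dist x y ≤ R) {z e y : E n}
    (he : ‖e‖ = 1) {t₀ : ℝ} (ht₀ : t₀ ∈ sectionSet Ω z e y) : BddBelow (sectionSet Ω z e y) :=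
  ⟨t₀ - R, fun t ht => by
    linarith [(abs_le.1 (abs_sub_le_of_mem_sectionSet hR he ht ht₀)).1]⟩

/-- A section is an open interval, so below a known element only its lower end matters. -/
lemma mem_sectionSet_iff_sectionInf_lt (hΩo : IsOpen Ω) (hΩc : Convex ℝ Ω) {R : ℝ}
    (hR : ∀ x ∈ Ω, ∀ y ∈ Ω, dist x y ≤ R) {z e y : E n} (he : ‖e‖ = 1) {t₀ t : ℝ}
    (ht₀ : t₀ ∈ sectionSet Ω z e y) (ht : t ≤ t₀) :
    t ∈ sectionSet Ω z e y ↔ sectionInf Ω z e y < t := by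
  constructor
  · intro hmem
    obtain ⟨ε, hε, hsub⟩ := Metric.isOpen_iff.1 (isOpen_sectionSet hΩo z e y) t hmem
    have h1 : t - ε / 2 ∈ sectionSet Ω z e y := hsub (by
      rw [mem_ball, Real.dist_eq, sub_sub_cancel_left, abs_neg, abs_of_pos (by positivity)]
      linarith)
    exact (csInf_le (bddBelow_sectionSet hR he ht₀) h1).trans_lt (by linarith)
  · intro hlt
    obtain ⟨s, hs, hst⟩ := exists_lt_of_csInf_lt ⟨t₀, ht₀⟩ hlt
    exact (convex_sectionSet hΩc z e y).ordConnected.out hs ht₀ ⟨hst.le, ht⟩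

/-- Prolong the segment from `y₁` through `y₂` to length `r/2`, where height `D` is still in `Ω`.
Convexity puts `(1-l)t + lD` in the section over `y₂`, and `|D - t| ≤ R`. -/
lemma sectionInf_le_add (hΩc : Convex ℝ Ω) {R r D : ℝ} (hR : ∀ x ∈ Ω, ∀ y ∈ Ω, dist x y ≤ R)
    (hr : 0 < r) {z e : E n} (he : ‖e‖ = 1)
    (hD : ∀ y, ‖y‖ < r → D ∈ sectionSet Ω z e y) {y₁ y₂ : E n}
    (h₁ : ‖y₁‖ < r / 4) (h₂ : ‖y₂‖ < r / 4) :
    sectionInf Ω z e y₂ ≤ sectionInf Ω z e y₁ + 2 * R / r * ‖y₂ - y₁‖ := by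
  rcases eq_or_ne y₂ y₁ with rfl | hne
  · simp
  have hpos : 0 < ‖y₂ - y₁‖ := norm_pos_iff.2 (sub_ne_zero.2 hne)
  rw [← sub_le_iff_le_add]
  refine le_csInf ⟨D, hD y₁ (by linarith)⟩ fun t ht => ?_
  set l := ‖y₂ - y₁‖ / (r / 2) with hl
  have hl0 : 0 < l := by positivity
  have hl1 : l ≤ 1 := by
    rw [hl, div_le_one (by positivity)]
    linarith [norm_sub_le y₂ y₁]
  have hη : ‖l⁻¹ • (y₂ - y₁)‖ = r / 2 := by
    rw [norm_smul, norm_inv, Real.norm_of_nonneg hl0.le, hl]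
    field_simp
  have hmem : D ∈ sectionSet Ω z e (y₁ + l⁻¹ • (y₂ - y₁)) :=
    hD _ ((norm_add_le _ _).trans_lt (by rw [hη]; linarith))
  have hconv := hΩc ht hmem (sub_nonneg.2 hl1) hl0.le (sub_add_cancel 1 l)
  have e1 : (1 - l) • (z + y₁ + t • e) + l • (z + (y₁ + l⁻¹ • (y₂ - y₁)) + D • e) =
      z + y₂ + ((1 - l) * t + l * D) • e := by
    have : l • l⁻¹ • (y₂ - y₁) = y₂ - y₁ := smul_inv_smul₀ hl0.ne' _
    rw [smul_add l, smul_add l z, smul_add l y₁, this]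
    module
  rw [e1] at hconv
  have hle : sectionInf Ω z e y₂ ≤ (1 - l) * t + l * D :=
    csInf_le (bddBelow_sectionSet hR he (hD y₂ (by linarith))) hconv
  have hDt := (abs_le.1 (abs_sub_le_of_mem_sectionSet hR he ht (hD y₁ (by linarith)))).1
  have h3 : 2 * R / r * ‖y₂ - y₁‖ = l * R := by rw [hl]; field_simp
  rw [h3]
  nlinarith

/-- The boundary of a bounded convex open set is Lipschitz. -/
lemma exists_isLipschitzBoundary (hΩo : IsOpen Ω) (hΩc : Convex ℝ Ω)
    (hΩb : Bornology.IsBounded Ω) (hne : Ω.Nonempty) :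
    ∃ ρ L C₁ : ℝ, IsLipschitzBoundary Ω ρ L C₁ := by
  obtain ⟨x, hx⟩ := hne
  obtain ⟨r, hr, hball⟩ := Metric.isOpen_iff.1 hΩo x hx
  obtain ⟨R₁, hR₁⟩ := Metric.isBounded_iff.1 hΩb
  set R := max R₁ 1 with hRdef
  have hR : ∀ x ∈ Ω, ∀ y ∈ Ω, dist x y ≤ R := fun x hx y hy => (hR₁ hx hy).trans (le_max_left _ _)
  have hR0 : 0 < R := lt_of_lt_of_le one_pos (le_max_right _ _)
  set L := 2 * R / r with hL
  have hL0 : 0 < L := by positivity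
  -- `(L + 1)ρ ≤ r/4` with `C₁ = L + 1` keeps the cylinder below the height `D ≥ r`, at which every
  -- section is occupied.
  set ρ := min (1 / 2) (r / (4 * (L + 1))) with hρ
  have hρ0 : 0 < ρ := by positivity
  have hρ1 : (L + 1) * ρ ≤ r / 4 := by
    have h := min_le_right (1 / 2) (r / (4 * (L + 1)))
    rw [← hρ, le_div_iff₀ (by positivity)] at h
    linarith
  have hρr : ρ ≤ r / 4 := by nlinarith
  refine ⟨ρ, L, L + 1, hρ0, (min_le_left _ _).trans_lt (by norm_num), hL0, by linarith,
    fun z hz => ?_⟩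
  have hzn : z ∉ Ω := notMem_of_mem_frontier hΩo hz
  set D := ‖x - z‖ with hDdef
  have hDr : r ≤ D := by
    by_contra! h
    exact hzn (hball (by rwa [mem_ball_iff_norm']))
  have hD0 : 0 < D := hr.trans_le hDr
  set e := D⁻¹ • (x - z) with hedef
  have he : ‖e‖ = 1 := by
    rw [hedef, norm_smul, norm_inv, Real.norm_of_nonneg hD0.le, inv_mul_cancel₀ hD0.ne']
  have hDe : D • e = x - z := smul_inv_smul₀ hD0.ne' _
  have hD : ∀ y : E n, ‖y‖ < r → D ∈ sectionSet Ω z e y := fun y hy => by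
    apply hball
    rw [hDe, mem_ball_iff_norm, show z + y + (x - z) - x = y by abel]
    exact hy
  have hlip : ∀ y ∈ ball (0 : (Submodule.span ℝ {e})ᗮ) ρ,
      ∀ w ∈ ball (0 : (Submodule.span ℝ {e})ᗮ) ρ,
      |sectionInf Ω z e y - sectionInf Ω z e w| ≤ L * ‖y - w‖ := by
    intro y hy w hw
    rw [mem_ball_zero_iff] at hy hw
    have h1 := sectionInf_le_add hΩc hR hr he hD (y₁ := y) (y₂ := w)
      (hy.trans_le hρr) (hw.trans_le hρr)
    have h2 := sectionInf_le_add hΩc hR hr he hD (y₁ := w) (y₂ := y)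
      (hw.trans_le hρr) (hy.trans_le hρr)
    rw [norm_sub_rev] at h1
    rw [abs_le, Submodule.coe_norm, Submodule.coe_sub]
    constructor <;> linarith
  have h0D := hD 0 (by simpa using hr)
  -- The graph passes through `z`: the open segment from `z` to the interior point `x` lies in `Ω`,
  -- while `z` does not.
  have hzero : sectionInf Ω z e 0 = 0 := by
    have hiff : ∀ t ≤ D, (t ∈ sectionSet Ω z e 0 ↔ sectionInf Ω z e 0 < t) := fun t ht =>
      mem_sectionSet_iff_sectionInf_lt hΩo hΩc hR he h0D ht
    apply le_antisymm
    · by_contra! hpos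
      set t := min (sectionInf Ω z e 0) (D / 2) with ht
      have ht0 : 0 < t := lt_min hpos (by positivity)
      have htD : t < D := (min_le_right _ _).trans_lt (by linarith)
      have hseg : z + 0 + t • e ∈ openSegment ℝ z x := by
        refine ⟨1 - t / D, t / D, by rw [sub_pos, div_lt_one hD0]; exact htD, by positivity,
          by ring, ?_⟩
        rw [hedef, smul_smul, ← div_eq_mul_inv]
        module
      have hmem : z + 0 + t • e ∈ Ω := by
        have := hΩc.openSegment_closure_interior_subset_interior hz.1 (hΩo.interior_eq.symm ▸ hx) hseg
        exact interior_subset this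
      exact absurd ((hiff t htD.le).1 hmem) (not_lt.2 (min_le_left _ _))
    · by_contra! hneg
      have := (hiff 0 hD0.le).2 hneg
      simp only [sectionSet, Set.mem_ofPred_eq, add_zero, zero_smul] at this
      exact hzn this
  refine ⟨z, e, fun y => sectionInf Ω z e y, he, hlip, fun y hy => ?_, fun y hy t ht => ?_, 0,
    mem_ball_self (by positivity), 0, by rw [abs_zero]; positivity, by simp⟩
  · have h := hlip y hy 0 (mem_ball_self hρ0)
    rw [Submodule.coe_zero, hzero, sub_zero, sub_zero] at h
    rw [mem_ball_zero_iff] at hy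
    nlinarith [norm_nonneg y]
  · rw [mem_ball_zero_iff] at hy
    refine mem_sectionSet_iff_sectionInf_lt hΩo hΩc hR he (hD y (by
      rw [← Submodule.coe_norm]; linarith)) ?_
    linarith [le_abs_self t]

end Existence

/-! ### Convexity of the potential and mass balance. -/

section Transport

variable {n : ℕ} {Ω : Set (E n)} {Ωs : Set (Sph n)} {u : E n → EReal}

lemma neg_cost_eq_inner (x : E n) (y : Sph n) :
    -cost x y = ⟪gnomonic (y : E (n + 1)), x⟫_ℝ := by
  simp only [cost, gnomonic, PiLp.inner_apply, lastCoord, RCLike.inner_apply, conj_trivial]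
  rw [Finset.sum_div, ← Finset.sum_neg_distrib]
  exact Finset.sum_congr rfl fun i _ => by ring

lemma IsCExp.gnomonic_eq {x p : E n} {y : Sph n} (h : IsCExp x p y) :
    gnomonic (y : E (n + 1)) = p := by
  refine HasGradientAt.unique ?_ h.2
  simp only [neg_cost_eq_inner]
  exact (innerSL ℝ (gnomonic (y : E (n + 1)))).hasFDerivAt

lemma IsCConvex.ne_bot (hu : IsCConvex Ω Ωs u) {x : E n} (hx : x ∈ Ω) : u x ≠ ⊥ := by
  obtain ⟨A, ⟨q, hq⟩, -, hA⟩ := hu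
  rw [hA x hx]
  exact ne_bot_of_le_ne_bot (EReal.coe_ne_bot _)
    (le_iSup₂ (f := fun q (_ : q ∈ A) => ((-cost x q.1 + q.2 : ℝ) : EReal)) q hq)

lemma IsCConvex.le_combination (hu : IsCConvex Ω Ωs u) (hΩ : Convex ℝ Ω) {x y : E n}
    (hx : x ∈ Ω) (hy : y ∈ Ω) (hxt : u x ≠ ⊤) (hyt : u y ≠ ⊤) {t : ℝ} (ht0 : 0 ≤ t)
    (ht1 : t ≤ 1) :
    u (x + t • (y - x)) ≤ (((1 - t) * (u x).toReal + t * (u y).toReal : ℝ) : EReal) := by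
  have hxb := hu.ne_bot hx
  have hyb := hu.ne_bot hy
  obtain ⟨A, -, -, hA⟩ := hu
  have hmem : x + t • (y - x) ∈ Ω := hΩ.add_smul_sub_mem hx hy ⟨ht0, ht1⟩
  have hle : ∀ w ∈ Ω, u w ≠ ⊤ → u w ≠ ⊥ → ∀ q ∈ A, -cost w q.1 + q.2 ≤ (u w).toReal := by
    intro w hw hwt hwb q hq
    rw [← EReal.coe_le_coe_iff, EReal.coe_toReal hwt hwb, hA w hw]
    exact le_iSup₂ (f := fun q (_ : q ∈ A) => ((-cost w q.1 + q.2 : ℝ) : EReal)) q hq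
  rw [hA _ hmem]
  refine iSup₂_le fun q hq => EReal.coe_le_coe_iff.2 ?_
  have h1 := hle x hx hxt hxb q hq
  have h2 := hle y hy hyt hyb q hq
  rw [neg_cost_eq_inner] at h1 h2 ⊢
  rw [inner_add_right, inner_smul_right, inner_sub_right]
  nlinarith [mul_le_mul_of_nonneg_left h1 (sub_nonneg.2 ht1), mul_le_mul_of_nonneg_left h2 ht0]

lemma IsCConvex.inner_le_of_hasGradAt (hu : IsCConvex Ω Ωs u) (hΩ : Convex ℝ Ω) {x y p : E n}
    (hx : x ∈ Ω) (hy : y ∈ Ω) (hp : HasGradAt u p x) (hyt : u y ≠ ⊤) :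
    ⟪p, y - x⟫_ℝ ≤ (u y).toReal - (u x).toReal := by
  obtain ⟨hfin, hgrad⟩ := hp
  have hxt := hfin.self_of_nhds.1
  have hline : HasDerivAt (fun t : ℝ => x + t • (y - x)) (y - x) 0 := by
    simpa using ((hasDerivAt_id (0 : ℝ)).smul_const (y - x)).const_add x
  have hg : HasFDerivAt (fun z => (u z).toReal) (InnerProductSpace.toDual ℝ (E n) p)
      (x + (0 : ℝ) • (y - x)) := by
    rw [zero_smul, add_zero]
    exact hgrad.hasFDerivAt
  have hd := (hg.comp_hasDerivAt (0 : ℝ) hline).tendsto_slope_zero_right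
  rw [InnerProductSpace.toDual_apply_apply] at hd
  refine le_of_tendsto hd ?_
  filter_upwards [Ioo_mem_nhdsGT (zero_lt_one' ℝ)] with t ht
  have hmem : x + t • (y - x) ∈ Ω := hΩ.add_smul_sub_mem hx hy ⟨ht.1.le, ht.2.le⟩
  have hle := hu.le_combination hΩ hx hy hxt hyt ht.1.le ht.2.le
  have hle' := EReal.toReal_le_toReal hle (hu.ne_bot hmem) (EReal.coe_ne_top _)
  rw [EReal.toReal_coe] at hle'
  simp only [Function.comp_apply, zero_add, zero_smul, add_zero, smul_eq_mul]
  rw [inv_mul_le_iff₀ ht.1]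
  linarith

/-- Monotonicity of the subdifferential: add the subgradient inequalities at `x` and `x₀`. The one
at `x₀`, tested at `x`, also forces `u x₀` to be finite. -/
lemma IsCConvex.inner_nonneg (hu : IsCConvex Ω Ωs u) (hΩ : Convex ℝ Ω) {x x₀ p p₀ : E n}
    (hx : x ∈ Ω) (hx₀ : x₀ ∈ Ω) (hp : HasGradAt u p x) (hp₀ : p₀ ∈ subdiff Ω u x₀) :
    0 ≤ ⟪p - p₀, x - x₀⟫_ℝ := by
  have hxt := hp.1.self_of_nhds.1
  have hxb := hu.ne_bot hx
  have hx₀b := hu.ne_bot hx₀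
  have h1 := hp₀ x hx
  have hx₀t : u x₀ ≠ ⊤ := by
    intro h
    rw [h, EReal.top_add_coe, top_le_iff] at h1
    exact hxt h1
  have h2 := hu.inner_le_of_hasGradAt hΩ hx hx₀ hp hx₀t
  rw [← EReal.coe_toReal hx₀t hx₀b, ← EReal.coe_toReal hxt hxb, ← EReal.coe_add,
    EReal.coe_le_coe_iff] at h1
  rw [← neg_sub x x₀, inner_neg_right] at h2
  rw [inner_sub_left]
  linarith

lemma ae_mem_sourceMeasure (hΩ : IsOpen Ω) (K : E n → ℝ) : ∀ᵐ x ∂(sourceMeasure Ω K), x ∈ Ω :=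
  (withDensity_absolutelyContinuous _ _).ae_le (ae_restrict_mem hΩ.measurableSet)

/-- Mass balance: the slopes in `p₀ + C` are only used by points `x` of `Ω` with
`⟪ξ, x - x₀⟫ ≥ 0` for some `ξ ∈ C`. -/
lemma lintegral_gnomonicDensity_le (hn : 1 ≤ n) (hΩo : IsOpen Ω) (hΩc : Convex ℝ Ω) {K : E n → ℝ}
    (hΩsm : MeasurableSet Ωs) (hΩs : Ωs ⊆ lowerHemisphere n)
    (hmass : ∫⁻ y in Ωs, ENNReal.ofReal (-lastCoord y) ∂(sphereVolume n) =
      volume (ball (0 : E n) 1))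
    (hu : IsBrenierSolution Ω K Ωs u) {x₀ p₀ : E n} (hx₀ : x₀ ∈ Ω) (hp₀ : p₀ ∈ subdiff Ω u x₀)
    {C S : Set (E n)} (hC : MeasurableSet C) (hS : MeasurableSet S) (hSΩ : S ⊆ Ω)
    (hCS : ∀ ξ ∈ C, ∀ x ∈ Ω, 0 ≤ ⟪ξ, x - x₀⟫_ℝ → x ∈ S) :
    ∫⁻ q in {q | q - p₀ ∈ C}, ENNReal.ofReal (gnomonicDensity q) ≤
      ∫⁻ x in S, ENNReal.ofReal (K x) := by
  obtain ⟨hconv, T, hT, hTm, hTν, -⟩ := hu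
  have hD : MeasurableSet {q : E n | q - p₀ ∈ C} := (measurable_sub_const p₀) hC
  have hB : MeasurableSet
      {y : Sph n | y ∈ lowerHemisphere n ∧ gnomonic (y : E (n + 1)) ∈ {q : E n | q - p₀ ∈ C}} :=
    (measurableSet_lowerHemisphere n).inter
      ((measurable_gnomonic.comp measurable_subtype_coe) hD)
  refine (le_targetMeasure_gnomonic hn hΩsm hΩs hmass hD).trans ?_
  rw [← hTν, Measure.map_apply_of_aemeasurable hTm hB]
  have hsub : sourceMeasure Ω K (T ⁻¹'
      {y : Sph n | y ∈ lowerHemisphere n ∧ gnomonic (y : E (n + 1)) ∈ {q : E n | q - p₀ ∈ C}}) ≤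
      sourceMeasure Ω K S := by
    refine measure_mono_ae ?_
    filter_upwards [hT, ae_mem_sourceMeasure hΩo K] with x ⟨p, hp, hexp⟩ hx hxB
    have hxC : gnomonic (T x : E (n + 1)) - p₀ ∈ C := hxB.2
    rw [hexp.gnomonic_eq] at hxC
    exact hCS _ hxC x hx (hconv.inner_nonneg hΩc hx hx₀ hp hp₀)
  refine hsub.trans_eq ?_
  rw [sourceMeasure, withDensity_apply _ hS, Measure.restrict_restrict hS,
    Set.inter_eq_self_of_subset_left hSΩ]

/-- The cone stays within `3/2` of `p₀`, and `1 + (|p₀| + 3/2)² ≤ (|p₀| + 2)²`; this is the origin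
of the `-2` in the theorem. -/
lemma volume_truncatedCone_mul_le {v p₀ : E n} (hv : ‖v‖ = 1) {θ : ℝ} (hθ0 : 0 < θ)
    (hθ : θ ≤ 1 / 2) :
    ENNReal.ofReal ((‖p₀‖ + 2)⁻¹ ^ (n + 2)) * volume (truncatedCone v θ) ≤
      ∫⁻ q in {q | q - p₀ ∈ truncatedCone v θ}, ENNReal.ofReal (gnomonicDensity q) := by
  have hm := measurableSet_truncatedCone v θ
  have hD : MeasurableSet {q : E n | q - p₀ ∈ truncatedCone v θ} := (measurable_sub_const p₀) hm
  have hvol : volume {q : E n | q - p₀ ∈ truncatedCone v θ} = volume (truncatedCone v θ) :=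
    (measurePreserving_sub_right volume p₀).measure_preimage hm.nullMeasurableSet
  rw [← hvol, ← setLIntegral_const]
  refine setLIntegral_mono' hD fun q hq => ENNReal.ofReal_le_ofReal ?_
  obtain ⟨h1, h2, h3⟩ := hq
  set s := ⟪q - p₀, v⟫_ℝ
  have hξ : ‖q - p₀‖ ≤ 3 / 2 := by
    have h4 := norm_add_le (q - p₀ - s • v) (s • v)
    rw [sub_add_cancel, norm_smul, hv, mul_one, Real.norm_of_nonpos h2.le] at h4
    nlinarith
  have hq : ‖q‖ ≤ ‖p₀‖ + 3 / 2 := by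
    have := norm_add_le (q - p₀) p₀
    rw [sub_add_cancel] at this
    linarith
  have hs : √(1 + ‖q‖ ^ 2) ≤ ‖p₀‖ + 2 := by
    rw [Real.sqrt_le_left (by positivity)]
    nlinarith [norm_nonneg q, norm_nonneg p₀]
  unfold gnomonicDensity
  gcongr

end Transport

/-! ### The mass of the cap, and the constants. -/

lemma setLIntegral_cap_le {n : ℕ} (hn : 1 ≤ n) {Ω : Set (E n)} (hΩ : IsOpen Ω)
    (hb : Bornology.IsBounded Ω) {K : E n → ℝ} {C₀ r₀ δ : ℝ} (hC₀ : 0 < C₀) (hδ0 : 0 < δ)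
    (hδ1 : δ < 1)
    (hK : ∀ x ∈ Ω, bdist Ω x < r₀ → K x ≤ C₀ / bdist Ω x ^ δ) {ρ L C₁ : ℝ}
    (hlip : IsLipschitzBoundary Ω ρ L C₁) {z v : E n} (hz : z ∈ frontier Ω) (hv : v ≠ 0) {r h : ℝ}
    (hr : 0 < r) (hh : 0 < h) (hrh : r + h ≤ ρ / 2) (hhr : h ≤ r₀) :
    ∫⁻ x in {x | x ∈ Ω ∧ ‖x - z‖ < r ∧ bdist Ω x < h}, ENNReal.ofReal (K x) ≤
      ENNReal.ofReal (C₀ * (r ^ (n - 1) * ((1 + L) ^ (n - 1) * (h ^ (1 - δ) / (1 - δ))))) *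
        volume (ball (0 : (Submodule.span ℝ {v})ᗮ) 1) := by
  have hSm := measurableSet_cap hΩ z r h
  rw [ENNReal.ofReal_mul hC₀.le, mul_assoc]
  refine le_trans ?_ (mul_le_mul_right
    (setLIntegral_bdist_rpow_le hn hΩ hb hlip hz hv hr hh hrh hδ0 hδ1) _)
  rw [← lintegral_const_mul' _ _ ENNReal.ofReal_ne_top]
  refine setLIntegral_mono' hSm fun x hx => ?_
  rw [← ENNReal.ofReal_mul hC₀.le, mul_one_div]
  exact ENNReal.ofReal_le_ofReal (hK x hx.1 (hx.2.2.trans_le hhr))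

lemma blowupConst_mul_rpow_le {n : ℕ} (hn : 1 ≤ n) {C₀ R₀ L δ d m P : ℝ} (hC₀ : 0 < C₀)
    (hR₀ : 0 < R₀) (hL : 0 < L) (hδ0 : 0 < δ) (hδ1 : δ < 1) (hd : 0 < d) (hm : 0 < m)
    (hm2 : m ^ 2 = R₀ * d) (hP : 0 < P)
    (h : P⁻¹ ^ (n + 2) * ((d / (2 * m)) ^ (n - 1) / n) ≤
      C₀ * ((2 * m) ^ (n - 1) * ((1 + L) ^ (n - 1) * ((2 * d) ^ (1 - δ) / (1 - δ))))) :
    blowupConst n C₀ R₀ L δ * d ^ (-((1 - δ) / ((n : ℝ) + 2))) ≤ P := by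
  have hn0 : (0 : ℝ) < n := by exact_mod_cast hn
  have h1δ : 0 < 1 - δ := by linarith
  set θ := d / (2 * m) with hθ
  have hθ0 : 0 < θ := by positivity
  set Q := (6 * R₀ + 24 * R₀ ^ 2) ^ (((n : ℝ) - 1) / 2) with hQ
  have hQ0 : 0 < Q := by positivity
  -- This makes `θ^(n-1)` cancel between cone and cap.
  have h2m : 2 * m = 4 * R₀ * θ := by
    rw [hθ]
    field_simp
    nlinarith
  -- Here `Λ` has room to spare: `(4R₀)² = 16R₀² ≤ 6R₀ + 24R₀²`.
  have hRQ : (4 * R₀) ^ (n - 1) ≤ Q := by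
    have e1 : (4 * R₀) ^ (n - 1) = ((4 * R₀) ^ (2 : ℝ)) ^ (((n : ℝ) - 1) / 2) := by
      rw [← Real.rpow_mul (by positivity), mul_div_cancel₀ _ two_ne_zero, ← Real.rpow_natCast,
        Nat.cast_sub hn, Nat.cast_one]
    rw [e1]
    refine Real.rpow_le_rpow (by positivity) ?_ (div_nonneg ?_ zero_le_two)
    · rw [Real.rpow_two]
      nlinarith [sq_nonneg R₀]
    · rw [sub_nonneg]; exact_mod_cast hn
  have h2d : (2 * d) ^ (1 - δ) ≤ 2 ^ n * d ^ (1 - δ) := by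
    rw [Real.mul_rpow zero_le_two hd.le]
    gcongr
    calc (2 : ℝ) ^ (1 - δ) ≤ 2 ^ (1 : ℝ) :=
          Real.rpow_le_rpow_of_exponent_le one_le_two (by linarith)
      _ ≤ 2 ^ n := by rw [Real.rpow_one]; exact le_self_pow₀ one_le_two (by omega)
  set B := n * 2 ^ n * C₀ * (1 + L) ^ (n - 1) * Q with hB
  have hB0 : 0 < B := by positivity
  have hmain : P⁻¹ ^ (n + 2) ≤ B * d ^ (1 - δ) / (1 - δ) := by
    rw [h2m, mul_pow] at h
    have hθn : 0 < θ ^ (n - 1) / n := by positivity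
    refine le_of_mul_le_mul_right (h.trans ?_) hθn
    calc C₀ * ((4 * R₀) ^ (n - 1) * θ ^ (n - 1) *
          ((1 + L) ^ (n - 1) * ((2 * d) ^ (1 - δ) / (1 - δ))))
        ≤ C₀ * (Q * θ ^ (n - 1) * ((1 + L) ^ (n - 1) * (2 ^ n * d ^ (1 - δ) / (1 - δ)))) := by
          gcongr
      _ = B * d ^ (1 - δ) / (1 - δ) * (θ ^ (n - 1) / n) := by
          rw [hB]
          field_simp
  have hpow : (1 - δ) / B * d ^ (-(1 - δ)) ≤ P ^ (n + 2) := by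
    rw [inv_pow, inv_le_comm₀ (by positivity) (by positivity)] at hmain
    refine le_trans (le_of_eq ?_) hmain
    rw [Real.rpow_neg hd.le]
    field_simp
  have hn2 : (0 : ℝ) < n + 2 := by positivity
  have e2 : blowupConst n C₀ R₀ L δ * d ^ (-((1 - δ) / ((n : ℝ) + 2))) =
      ((1 - δ) / B * d ^ (-(1 - δ))) ^ (1 / ((n : ℝ) + 2)) := by
    rw [Real.mul_rpow (by positivity) (by positivity), ← Real.rpow_mul hd.le, blowupConst]
    congr 2
    ring
  rw [e2]
  calc ((1 - δ) / B * d ^ (-(1 - δ))) ^ (1 / ((n : ℝ) + 2))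
      ≤ (P ^ (n + 2)) ^ (1 / ((n : ℝ) + 2)) :=
        Real.rpow_le_rpow (by positivity) hpow (by positivity)
    _ = P := by
        rw [← Real.rpow_natCast, ← Real.rpow_mul hP.le]
        push_cast
        rw [mul_one_div_cancel hn2.ne', Real.rpow_one]

end GaussOT

end

theorem theorem2p3 (n : ℕ) (hn : 1 ≤ n)
    (Ω : Set (GaussOT.E n)) (hΩo : IsOpen Ω) (hΩc : Convex ℝ Ω) (hΩb : Bornology.IsBounded Ω)
    (K : GaussOT.E n → ℝ) (hKm : Measurable fun x : Ω => K x) (hK0 : ∀ x ∈ Ω, 0 ≤ K x)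
    (hKsupp : closure Ω = closure {x | x ∈ Ω ∧ 0 < K x})
    (hKmass : ∫⁻ x in Ω, ENNReal.ofReal (K x) = volume (Metric.ball (0 : GaussOT.E n) 1))
    (Ωs : Set (GaussOT.Sph n)) (hΩsm : MeasurableSet Ωs)
    (hΩs : Ωs ⊆ GaussOT.lowerHemisphere n)
    (hmass : ∫⁻ x in Ω, ENNReal.ofReal (K x) =
      ∫⁻ y in Ωs, ENNReal.ofReal (-GaussOT.lastCoord y) ∂(GaussOT.sphereVolume n))
    (u : GaussOT.E n → EReal) (hu : GaussOT.IsBrenierSolution Ω K Ωs u)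
    (C₀ r₀ δ R₀ : ℝ) (hC₀ : 0 < C₀) (hr₀ : 0 < r₀) (hδ0 : 0 < δ) (hδ1 : δ < 1) (hR₀ : 0 < R₀)
    (hKdecay : ∀ x ∈ Ω, GaussOT.bdist Ω x < r₀ → K x ≤ C₀ / GaussOT.bdist Ω x ^ δ)
    (hball : GaussOT.EnclosingBallCondition Ω R₀) :
    (∃ ρ L C₁ : ℝ, GaussOT.IsLipschitzBoundary Ω ρ L C₁) ∧
    ∀ ρ L C₁ : ℝ, GaussOT.IsLipschitzBoundary Ω ρ L C₁ →
      ∀ x₀ ∈ Ω, ∀ p₀ ∈ GaussOT.subdiff Ω u x₀,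
        GaussOT.bdist Ω x₀ ≤ min (ρ ^ 2 / (16 * (1 + 4 * R₀))) (min (r₀ / 2) (1 / 4)) →
          GaussOT.blowupConst n C₀ R₀ L δ *
              GaussOT.bdist Ω x₀ ^ (-((1 - δ) / ((n : ℝ) + 2))) - 2 ≤ ‖p₀‖ := by
  have hne : Ω.Nonempty := by
    rw [Set.nonempty_iff_ne_empty]
    rintro rfl
    rw [Measure.restrict_empty, lintegral_zero_measure] at hKmass
    exact (measure_ball_pos volume (0 : GaussOT.E n) one_pos).ne hKmass
  refine ⟨GaussOT.exists_isLipschitzBoundary hΩo hΩc hΩb hne,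
    fun ρ L C₁ hlip x₀ hx₀ p₀ hp₀ hd => ?_⟩
  obtain ⟨hdρ, hdr, hd4⟩ : _ ∧ _ ∧ _ := by simpa only [le_min_iff] using hd
  obtain ⟨z, hz, hdz⟩ := GaussOT.exists_frontier_bdist_eq hn hΩb hx₀
  have hpos := GaussOT.bdist_pos hn hΩo hΩb hx₀
  obtain ⟨hdR, -⟩ := GaussOT.enclosing_ball_estimate hn hΩo hΩb hball hx₀ hz hdz
  set d := GaussOT.bdist Ω x₀ with hddef
  -- A cap of depth `d` in a ball of radius `R₀` has width of order `√(R₀d)`.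
  set m := √(R₀ * d) with hmdef
  have hm : 0 < m := Real.sqrt_pos.2 (by positivity)
  have hm2 : m ^ 2 = R₀ * d := Real.sq_sqrt (by positivity)
  set v := d⁻¹ • (x₀ - z) with hvdef
  have hv : ‖v‖ = 1 := by
    rw [hvdef, norm_smul, norm_inv, Real.norm_of_nonneg hpos.le, ← dist_eq_norm, ← hdz,
      inv_mul_cancel₀ hpos.ne']
  have hv0 : v ≠ 0 := by rintro h; simp [h] at hv
  have hdm : d ≤ m := Real.le_sqrt_of_sq_le (by nlinarith)
  have hθ : d / (2 * m) ≤ 1 / 2 := by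
    rw [div_le_div_iff₀ (by positivity) (by positivity)]
    linarith
  -- `(2m + 2d)² ≤ 8(R₀d + d²) ≤ 2d(1 + 4R₀)` by `d ≤ 1/4`, and the bound on `d` makes this at most
  -- `ρ²/8`.
  have hrh : 2 * m + 2 * d ≤ ρ / 2 := by
    rw [le_div_iff₀ (by positivity)] at hdρ
    have hρ := hlip.1
    refine abs_le_of_sq_le_sq' ?_ (by positivity) |>.2
    nlinarith [sq_nonneg (m - d)]
  have h1 := GaussOT.lintegral_gnomonicDensity_le hn hΩo hΩc hΩsm hΩs (hmass.symm.trans hKmass) hu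
    hx₀ hp₀ (GaussOT.measurableSet_truncatedCone v (d / (2 * m)))
    (GaussOT.measurableSet_cap hΩo z (2 * m) (2 * d)) (fun x hx => hx.1)
    (fun ξ hξ x hx hin => ⟨hx, GaussOT.mem_cap_of_inner_nonneg hn hΩo hΩb hR₀ hball hx₀ hz hdz hm
      hm2 hξ hx hin⟩)
  have h2 := GaussOT.setLIntegral_cap_le hn hΩo hΩb hC₀ hδ0 hδ1 hKdecay hlip hz hv0
    (r := 2 * m) (h := 2 * d) (by positivity) (by positivity) hrh (by linarith)
  have h3 := (GaussOT.volume_truncatedCone_mul_le (p₀ := p₀) hv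
    (by positivity : 0 < d / (2 * m)) hθ).trans (h1.trans h2)
  have h1δ : 0 < 1 - δ := by linarith
  have hL := hlip.2.2.1
  rw [GaussOT.volume_truncatedCone hn hv (by positivity), ← mul_assoc,
    ← ENNReal.ofReal_mul (by positivity),
    ENNReal.mul_le_mul_iff_left (measure_ball_pos volume _ one_pos).ne' measure_ball_lt_top.ne,
    ENNReal.ofReal_le_ofReal_iff (by positivity)] at h3
  have h4 := GaussOT.blowupConst_mul_rpow_le hn hC₀ hR₀ hL hδ0 hδ1 hpos hm hm2
    (by positivity : 0 < ‖p₀‖ + 2) h3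
  linarith
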